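/- Let $F$ be an elliptic function field over the finite field $\mathbb{F}_q$, i.e. the function field of an elliptic curve over $\mathbb{F}_q$. Let $\mathrm{Cl}\,F$ be its divisor class group and let the class number $h$ be the number of divisor classes of degree $0$. An unramified Hecke character is a (not necessarily unitary) character $\chi:\mathrm{Cl}\,F\to\mathbb{C}^\times$; its $L$-function $L(\chi,s)$ is the meromorphic continuation to $\mathbb{C}$ of the series $\sum_{D\ge 0}\chi(D)\,q^{-s\deg D}$ over all effective divisors $D$ of $F$, which converges absolutely for $\mathrm{Re}(s)$ sufficiently large. Suppose that the characteristic of $F$ is not $2$ or that $h\neq q+1$. Then for every unramified Hecke character $\chi$ and every $s\in\mathbb{C}$ there is an unramified Hecke character $\omega$ with $\omega^2=1$ (the trivial character is allowed) such that $L(\chi\omega,\cdot)$ is holomorphic at $s$ and $L(\chi\omega,s)\neq 0$. -/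

import Mathlib

noncomputable section

/-- `F` is an elliptic function field over `k`: it is `k`-isomorphic to the function field of an
elliptic curve over `k`. -/
def IsEllipticFunctionField (k F : Type*) [Field k] [Field F] [Algebra k F] : Prop :=
  ∃ W : WeierstrassCurve k, W.IsElliptic ∧ Nonempty (F ≃ₐ[k] W.toAffine.FunctionField)

/-- A place of `F / k` (a closed point of the smooth projective curve with function field `F`):
a discrete valuation ring of `F` that contains `k`. -/
structure FFPlace (k F : Type*) [Field k] [Field F] [Algebra k F] where
  ring : ValuationSubring F
  isDVR : IsDiscreteValuationRing ring
  algebraMap_mem : ∀ c : k, algebraMap k F c ∈ ring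

namespace FFPlace

variable {k F : Type*} [Field k] [Field F] [Algebra k F]

instance (x : FFPlace k F) : IsDiscreteValuationRing x.ring := x.isDVR

instance (x : FFPlace k F) : Algebra k x.ring :=
  ((algebraMap k F).codRestrict x.ring.toSubring x.algebraMap_mem).toAlgebra

/-- The degree of a place: the degree of its residue field over `k`. -/
def deg (x : FFPlace k F) : ℕ :=
  Module.finrank k (IsLocalRing.ResidueField x.ring)

/-- The normalised (additive) discrete valuation of `F` at a place; it is used on nonzero
elements only. -/
def ord (x : FFPlace k F) (f : F) : ℤ :=
  -WithZero.log ((IsDiscreteValuationRing.maximalIdeal x.ring).valuation F f)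

theorem ord_one (x : FFPlace k F) : x.ord 1 = 0 := by
  simp [ord]

theorem ord_mul (x : FFPlace k F) {f g : F} (hf : f ≠ 0) (hg : g ≠ 0) :
    x.ord (f * g) = x.ord f + x.ord g := by
  unfold ord
  rw [map_mul, WithZero.log_mul (by simpa using hf) (by simpa using hg), neg_add]

theorem ord_inv (x : FFPlace k F) (f : F) : x.ord f⁻¹ = -x.ord f := by
  unfold ord
  rw [map_inv₀, WithZero.log_inv]

end FFPlace

section ClassGroup

variable (k F : Type*) [Field k] [Field F] [Algebra k F]

/-- The group of divisors of `F / k`. -/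
abbrev FFDivisor : Type _ := FFPlace k F →₀ ℤ

/-- The degree of a divisor. -/
def FFDivisor.deg : FFDivisor k F →+ ℤ :=
  Finsupp.liftAddHom fun x : FFPlace k F => AddMonoidHom.mulRight (x.deg : ℤ)

/-- The group of principal divisors. -/
def FFDivisor.principal : AddSubgroup (FFDivisor k F) where
  carrier := {D | ∃ f : F, f ≠ 0 ∧ ∀ x : FFPlace k F, D x = x.ord f}
  zero_mem' := ⟨1, one_ne_zero, fun x => by simp [x.ord_one]⟩
  add_mem' := by
    rintro D E ⟨f, hf, hD⟩ ⟨g, hg, hE⟩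
    exact ⟨f * g, mul_ne_zero hf hg, fun x => by
      rw [Finsupp.add_apply, hD, hE, x.ord_mul hf hg]⟩
  neg_mem' := by
    rintro D ⟨f, hf, hD⟩
    exact ⟨f⁻¹, inv_ne_zero hf, fun x => by rw [Finsupp.neg_apply, hD, x.ord_inv]⟩

/-- The divisor class group. -/
abbrev FFClassGroup : Type _ := FFDivisor k F ⧸ FFDivisor.principal k F

/-- The subgroup of classes of divisors of degree zero. -/
def FFClassGroup.degZero : AddSubgroup (FFClassGroup k F) :=
  (FFDivisor.deg k F).ker.map (QuotientAddGroup.mk' (FFDivisor.principal k F))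

/-- The class number: the number of divisor classes of degree zero. -/
def FFClassGroup.classNumber : ℕ := Nat.card (FFClassGroup.degZero k F)

/-- An unramified Hecke character: a (not necessarily unitary) character `Cl F → ℂˣ`. The value of
an `AddChar` on a group is automatically nonzero. -/
abbrev UnramifiedHeckeCharacter : Type _ := AddChar (FFClassGroup k F) ℂ

end ClassGroup

section LSeries

variable {k F : Type*} [Field k] [Field F] [Algebra k F]

/-- The term `χ(D) · N(D) ^ (-s)` of the `L`-series, where `N(D) = q ^ deg D`. -/
def heckeLTerm (χ : UnramifiedHeckeCharacter k F) (s : ℂ) (D : FFDivisor k F) : ℂ :=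
  χ (QuotientAddGroup.mk D) * (Nat.card k : ℂ) ^ (-(FFDivisor.deg k F D : ℂ) * s)

/-- `L` is the meromorphic continuation to `ℂ` of the `L`-series `∑ χ(D) N(D) ^ (-s)`, summed over
all effective divisors `D`, which converges absolutely on some right half plane. The normal form
fixes the values of `L`: the removable singularities are removed, and the value at a pole is `0`. -/
def IsHeckeLFunction (χ : UnramifiedHeckeCharacter k F) (L : ℂ → ℂ) : Prop :=
  MeromorphicNFOn L Set.univ ∧
    ∃ σ : ℝ, ∀ s : ℂ, σ < s.re →
      HasSum (fun D : {D : FFDivisor k F // 0 ≤ D} => heckeLTerm χ s D.1) (L s)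

open Classical in
/-- The Hecke `L`-function `L(χ, s)` (the zero function, should no continuation exist). -/
def heckeL (χ : UnramifiedHeckeCharacter k F) : ℂ → ℂ :=
  if h : ∃ L : ℂ → ℂ, IsHeckeLFunction χ L then h.choose else 0

end LSeries

end

/-! Fix the rational point `∞` at infinity. Since it has degree one, the class group splits as `Cl⁰
⊕ ℤ·[∞]`, and every effective divisor is sorted by its degree-zero part and its degree. In genus one
the number of effective divisors in a class of degree `n ≥ 1` is `(q ^ n - 1) / (q - 1)`, whatever
the class; in degree zero only the trivial class contains one. With `u = χ([∞]) q ^ (-s)` and `S`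
the sum of `χ` over `Cl⁰`, summing geometric series gives `L(χ, s) = 1 + S u / ((1 - u) (1 - q u))`.

If `χ` is nontrivial on `Cl⁰`, then `S = 0` by orthogonality and `L` is identically `1`, so `ω = 1`
works. Let `χ` be trivial on `Cl⁰`, so that `S = h`. If `h` is even, `Cl⁰` has a character of order
two; extended along the splitting it makes `χω` nontrivial on `Cl⁰`. If `h` is odd, the candidates
are `1` and `(-1) ^ deg`, and the second replaces `u` by `-u`. Both fail only if `u` and `-u` are
both poles or zeros, which forces `h = 2 (q + 1)` or `h = q + 1` (`eq_or_eq_of_exceptional`). The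
first is even. The second is even for odd `q`, and in characteristic two it is excluded by
hypothesis.

The count (`card_effective_of_pos`) rests on an elementary form of Riemann–Roch. The affine
coordinate ring is Dedekind because the curve is smooth, its primes are the places other than `∞`,
and its elements with a pole of order at most `n ≥ 1` at `∞` form a space of dimension `n`. A
dimension count then makes every divisor of positive degree equivalent to an effective one
(`exists_effective`), so each class of degree one is the class of a rational point.
`IsEllipticModel` collects what this argument needs to know about the curve. -/

section

/-! ### Places and their normalised valuations -/

open WithZero

namespace FFPlace

variable {k F : Type*} [Field k] [Field F] [Algebra k F]

/-- The normalised multiplicative valuation of `F` at a place. -/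
noncomputable def valuation (x : FFPlace k F) : Valuation F ℤᵐ⁰ :=
  (IsDiscreteValuationRing.maximalIdeal x.ring).valuation F

theorem ord_def (x : FFPlace k F) (f : F) : x.ord f = -log (x.valuation f) := rfl

theorem valuation_eq_exp (x : FFPlace k F) {f : F} (hf : f ≠ 0) :
    x.valuation f = exp (-x.ord f) := by
  rw [ord_def, neg_neg, exp_log]
  simpa using hf

theorem valuation_le_one_iff (x : FFPlace k F) (f : F) : x.valuation f ≤ 1 ↔ f ∈ x.ring := by
  constructor
  · intro h
    obtain ⟨a, rfl⟩ := IsDiscreteValuationRing.exists_lift_of_le_one h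
    exact a.2
  · intro h
    exact (IsDiscreteValuationRing.maximalIdeal x.ring).valuation_le_one (K := F) ⟨f, h⟩

theorem valuation_surjective (x : FFPlace k F) : Function.Surjective x.valuation :=
  (IsDiscreteValuationRing.maximalIdeal x.ring).valuation_surjective F

theorem valuation_lt_one_iff (x : FFPlace k F) (f : x.ring) :
    x.valuation f < 1 ↔ f ∈ IsLocalRing.maximalIdeal x.ring :=
  (IsDiscreteValuationRing.maximalIdeal x.ring).valuation_lt_one_iff_mem (K := F) f

theorem ord_nonneg_iff (x : FFPlace k F) {f : F} (hf : f ≠ 0) : 0 ≤ x.ord f ↔ f ∈ x.ring := by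
  rw [← valuation_le_one_iff, x.valuation_eq_exp hf, ← exp_zero, exp_le_exp]
  omega

theorem ord_pos_iff (x : FFPlace k F) {f : F} (hf : f ≠ 0) : 0 < x.ord f ↔ x.valuation f < 1 := by
  rw [x.valuation_eq_exp hf, ← exp_zero, exp_lt_exp]
  omega

theorem ord_eq_zero_iff (x : FFPlace k F) {f : F} (hf : f ≠ 0) :
    x.ord f = 0 ↔ x.valuation f = 1 := by
  rw [x.valuation_eq_exp hf, ← exp_zero, exp_inj]
  omega

theorem ord_algebraMap (x : FFPlace k F) {c : k} (hc : c ≠ 0) : x.ord (algebraMap k F c) = 0 := by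
  have h0 : algebraMap k F c ≠ 0 := by simpa using hc
  have h1 := (x.ord_nonneg_iff h0).2 (x.algebraMap_mem c)
  have h2 := (x.ord_nonneg_iff (inv_ne_zero h0)).2 (by
    rw [← map_inv₀]; exact x.algebraMap_mem _)
  rw [ord_inv] at h2
  omega

theorem ext_ring {x y : FFPlace k F} (h : x.ring = y.ring) : x = y := by
  cases x; cases y; congr

theorem ring_ne_top (x : FFPlace k F) : x.ring ≠ ⊤ := by
  intro h
  obtain ⟨f, hf⟩ := x.valuation_surjective (exp 1)
  have : x.valuation f ≤ 1 := (x.valuation_le_one_iff f).2 (h ▸ ValuationSubring.mem_top f)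
  rw [hf, ← exp_zero, exp_le_exp] at this
  omega

/-- A surjective valuation whose valuation ring is that of a place is the normalised valuation. -/
theorem valuation_eq_of_mem_iff (x : FFPlace k F) (v : Valuation F ℤᵐ⁰)
    (hv : Function.Surjective v) (h : ∀ f, v f ≤ 1 ↔ f ∈ x.ring) (f : F) :
    v f = x.valuation f := by
  have he : v.IsEquiv x.valuation := by
    rw [Valuation.isEquiv_iff_val_le_one]
    intro f
    rw [h, valuation_le_one_iff]
  obtain ⟨π, hπ⟩ := x.valuation_surjective (exp (-1))
  obtain ⟨ρ, hρ⟩ := hv (exp (-1))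
  -- As `exp (-1)` is the largest value below `1`, equivalence of the two valuations forces a
  -- uniformiser of one to be a uniformiser of the other.
  have key : ∀ a : ℤᵐ⁰, a < 1 → a ≤ exp (-1) := by
    intro a ha
    rcases eq_or_ne a 0 with rfl | h0
    · simp
    · rw [← exp_log h0, ← exp_zero, exp_lt_exp] at ha
      rw [← exp_log h0, exp_le_exp]
      omega
  have hlt : (exp (-1) : ℤᵐ⁰) < 1 := by rw [← exp_zero, exp_lt_exp]; omega
  have h1 : v π = exp (-1) := by
    apply le_antisymm
    · apply key
      rw [he.lt_one_iff_lt_one, hπ]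
      exact hlt
    · rw [← hρ, he, hπ]
      apply key
      rw [← he.lt_one_iff_lt_one, hρ]
      exact hlt
  rcases eq_or_ne f 0 with rfl | hf
  · simp
  have hπ0 : π ≠ 0 := by
    rintro rfl
    rw [map_zero] at hπ
    exact exp_ne_zero hπ.symm
  have h2 : x.valuation (f * π ^ (-x.ord f)) = 1 := by
    rw [map_mul, map_zpow₀, hπ, x.valuation_eq_exp hf, ← exp_zsmul, ← exp_add, ← exp_zero]
    congr 1
    simp
  rw [← he.eq_one_iff_eq_one, map_mul, map_zpow₀, h1, ← exp_zsmul] at h2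
  rw [x.valuation_eq_exp hf, eq_inv_of_mul_eq_one_left h2, ← exp_neg]
  simp

/-- The place attached to a surjective discrete valuation that is trivial on constants. -/
noncomputable def ofValuation (v : Valuation F ℤᵐ⁰) (hv : Function.Surjective v)
    (hk : ∀ c : k, v (algebraMap k F c) ≤ 1) : FFPlace k F where
  ring := v.valuationSubring
  isDVR := by
    have : Nontrivial (MonoidWithZeroHom.valueGroup (.ofClass v)) := by
      obtain ⟨π, hπ⟩ := hv (exp (-1))
      rw [Subgroup.nontrivial_iff_exists_ne_one]
      refine ⟨Units.mk0 (v π) (by simp [hπ]), MonoidWithZeroHom.mem_valueGroup _ ⟨π, rfl⟩, ?_⟩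
      intro h
      have := congrArg Units.val h
      simp only [Units.val_mk0, Units.val_one] at this
      rw [hπ, ← exp_zero, exp_inj] at this
      omega
    infer_instance
  algebraMap_mem := hk

theorem valuation_ofValuation (v : Valuation F ℤᵐ⁰) (hv : Function.Surjective v)
    (hk : ∀ c : k, v (algebraMap k F c) ≤ 1) (f : F) :
    (ofValuation v hv hk).valuation f = v f :=
  ((ofValuation v hv hk).valuation_eq_of_mem_iff v hv (fun _ => Iff.rfl) f).symm

theorem deg_eq_one (x : FFPlace k F)
    (h : ∀ f ∈ x.ring, ∃ c : k, x.valuation (f - algebraMap k F c) < 1) : x.deg = 1 := by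
  unfold deg
  have hb : Function.Bijective (Algebra.linearMap k (IsLocalRing.ResidueField x.ring)) := by
    refine ⟨(algebraMap k (IsLocalRing.ResidueField x.ring)).injective, fun y => ?_⟩
    obtain ⟨f, rfl⟩ := IsLocalRing.residue_surjective y
    obtain ⟨c, hc⟩ := h f f.2
    refine ⟨c, ?_⟩
    rw [Algebra.linearMap_apply, IsScalarTower.algebraMap_apply k x.ring,
      IsLocalRing.ResidueField.algebraMap_eq, eq_comm, ← sub_eq_zero, ← map_sub,
      IsLocalRing.residue_eq_zero_iff, ← valuation_lt_one_iff]
    exact hc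
  rw [← (LinearEquiv.ofBijective _ hb).finrank_eq, Module.finrank_self]

/-- When `R` meets every residue class at `x`, reduction maps `R` onto the residue field with kernel
`P`. -/
theorem deg_eq_finrank_quotient (x : FFPlace k F) {R : Type*} [CommRing R] [Algebra k R]
    [Algebra R F] [IsScalarTower k R F] (P : Ideal R) (hR : ∀ r : R, algebraMap R F r ∈ x.ring)
    (hP : ∀ r : R, r ∈ P ↔ x.valuation (algebraMap R F r) < 1)
    (hs : ∀ f ∈ x.ring, ∃ r : R, x.valuation (f - algebraMap R F r) < 1) :
    x.deg = Module.finrank k (R ⧸ P) := by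
  let g : R →ₐ[k] x.ring :=
    { (algebraMap R F).codRestrict x.ring.toSubring hR with
      commutes' := fun c => Subtype.ext (IsScalarTower.algebraMap_apply k R F c).symm }
  have hg : ∀ r, ((g r : x.ring) : F) = algebraMap R F r := fun r => rfl
  let φ : R →ₐ[k] IsLocalRing.ResidueField x.ring :=
    (IsScalarTower.toAlgHom k x.ring (IsLocalRing.ResidueField x.ring)).comp g
  have hφ : ∀ r, φ r = IsLocalRing.residue x.ring (g r) := fun r => rfl
  have hsurj : Function.Surjective φ := by
    intro y
    obtain ⟨f, rfl⟩ := IsLocalRing.residue_surjective y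
    obtain ⟨r, hr⟩ := hs f f.2
    refine ⟨r, ?_⟩
    rw [hφ, eq_comm, ← sub_eq_zero, ← map_sub, IsLocalRing.residue_eq_zero_iff,
      ← valuation_lt_one_iff]
    exact hr
  have hker : RingHom.ker φ = P := by
    ext r
    rw [RingHom.mem_ker, hφ, IsLocalRing.residue_eq_zero_iff, ← valuation_lt_one_iff, hP, hg]
  subst hker
  exact (Ideal.quotientKerAlgEquivOfSurjective hsurj).toLinearEquiv.finrank_eq.symm

end FFPlace

end

/-! ### The affine coordinate ring is a Dedekind domain -/

section

open Polynomial
open scoped Polynomial.Bivariate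

theorem exists_extend_fractionRing {A R L : Type*} [CommRing A] [CommRing R] [IsDomain R] [Field L]
    [Algebra A R] [Algebra R L] [Algebra A L] [IsScalarTower A R L] [IsFractionRing R L]
    (c : R →ₐ[A] R) (hc : Function.Injective c) :
    ∃ σ : L →ₐ[A] L, ∀ r, σ (algebraMap R L r) = algebraMap R L (c r) := by
  have hinj : Function.Injective ((IsScalarTower.toAlgHom A R L).comp c) :=
    (IsFractionRing.injective R L).comp hc
  exact ⟨IsFractionRing.liftAlgHom hinj, fun r => IsFractionRing.lift_algebraMap hinj r⟩

namespace WeierstrassCurve.Affine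

variable {k : Type*} [Field k] (W : Affine k)

/-- The linear coefficient `a₁ X + a₃` of the Weierstrass equation. -/
noncomputable def linCoeff : k[X] := C W.a₁ * X + C W.a₃

/-- The cubic `X³ + a₂ X² + a₄ X + a₆` of the Weierstrass equation. -/
noncomputable def cubic : k[X] := X ^ 3 + C W.a₂ * X ^ 2 + C W.a₄ * X + C W.a₆

variable {W}

/-- Over `k[X]/(p)` the root of `p` and the residue of `y` define a point of the curve. The two
divisibilities make both partial derivatives vanish there, which contradicts smoothness. -/
theorem not_singular_modulo_irreducible [W.IsElliptic] {p y : k[X]} (hp : Irreducible p)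
    (h1 : p ^ 2 ∣ y ^ 2 + y * W.linCoeff - W.cubic) (h2 : p ∣ 2 * y + W.linCoeff) : False := by
  have : Fact (Irreducible p) := ⟨hp⟩
  let φ : k →+* AdjoinRoot p := AdjoinRoot.of p
  let WK : Affine (AdjoinRoot p) := W.map φ
  have hell : WK.IsElliptic := inferInstanceAs (W.map φ).IsElliptic
  have e1 : AdjoinRoot.mk p (y ^ 2 + y * W.linCoeff - W.cubic) = 0 :=
    AdjoinRoot.mk_eq_zero.2 ((dvd_pow_self p two_ne_zero).trans h1)
  have e2 : AdjoinRoot.mk p (2 * y + W.linCoeff) = 0 := AdjoinRoot.mk_eq_zero.2 h2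
  -- Divisibility by `p ^ 2` survives differentiation as divisibility by `p`; by the chain rule and
  -- `e2`, the partial derivative in `X` then vanishes.
  have e3 : AdjoinRoot.mk p (derivative (y ^ 2 + y * W.linCoeff - W.cubic)) = 0 := by
    obtain ⟨g, hg⟩ := h1
    rw [hg, AdjoinRoot.mk_eq_zero]
    refine ⟨2 * derivative p * g + p * derivative g, ?_⟩
    simp only [derivative_mul, derivative_pow, Nat.cast_ofNat, C_ofNat]
    ring
  simp only [linCoeff, cubic, map_add, map_sub, map_mul, map_pow, AdjoinRoot.mk_C,
    AdjoinRoot.mk_X, map_ofNat, derivative_mul, derivative_pow,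
    derivative_C, derivative_X, Nat.cast_ofNat, map_zero, map_one] at e1 e2 e3
  set x := AdjoinRoot.root p
  set v := AdjoinRoot.mk p y
  have heq : WK.Equation x v := by
    rw [equation_iff]
    simp only [WK, map_a₁, map_a₂, map_a₃, map_a₄, map_a₆, φ]
    linear_combination e1
  have hns := equation_iff_nonsingular.1 heq
  rw [nonsingular_iff'] at hns
  simp only [WK, map_a₁, map_a₂, map_a₃, map_a₄, φ] at hns
  rcases hns.2 with h | h
  · apply h
    linear_combination e3 - AdjoinRoot.mk p (derivative y) * e2
  · apply h
    linear_combination e2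

/-- The two expressions are the trace and norm of `a + b Y`. If `p` did not divide `b`, then `-a /
b` modulo `p ^ 2` would be a singular point modulo `p`. -/
theorem dvd_of_dvd_trace_of_sq_dvd_norm [W.IsElliptic] {p a b : k[X]} (hp : Irreducible p)
    (h1 : p ∣ 2 * a - b * W.linCoeff)
    (h2 : p ^ 2 ∣ a ^ 2 - a * b * W.linCoeff - b ^ 2 * W.cubic) : p ∣ a ∧ p ∣ b := by
  by_cases hb : p ∣ b
  · refine ⟨hp.prime.dvd_of_dvd_pow (n := 2) ?_, hb⟩
    have h3 := (dvd_pow_self p two_ne_zero).trans h2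
    have h4 : p ∣ b * (a * W.linCoeff + b * W.cubic) := hb.mul_right _
    convert dvd_add h3 h4 using 1
    ring
  · exfalso
    have hco : IsCoprime b (p ^ 2) := ((hp.coprime_iff_not_dvd.2 hb).symm).pow_right
    obtain ⟨c, e, hce⟩ := hco
    obtain ⟨s, hs⟩ := h2
    obtain ⟨t, ht⟩ := h1
    -- Here `c` is an inverse of `b` modulo `p ^ 2`; the witnesses below absorb the error `e * p ^
    -- 2`.
    apply not_singular_modulo_irreducible (W := W) (y := -(a * c)) hp
    · refine ⟨c ^ 2 * s + e * (-(a * c) * W.linCoeff - W.cubic * (1 + b * c)), ?_⟩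
      linear_combination c ^ 2 * hs + (a * c * W.linCoeff + (1 + c * b) * W.cubic) * hce
    · refine ⟨-(c * t) + e * p * W.linCoeff, ?_⟩
      linear_combination -c * ht + (-W.linCoeff) * hce

namespace CoordinateRing

variable (W)

theorem mk_Y_sq : mk W Y ^ 2 + algebraMap k[X] W.CoordinateRing W.linCoeff * mk W Y =
    algebraMap k[X] W.CoordinateRing W.cubic := by
  have h := smul_basis_mul_Y (W' := W) 0 1
  simp only [one_mul, zero_sub, Algebra.smul_def, mul_one] at h
  rw [linCoeff, cubic]
  simp only [map_neg, map_zero, map_one] at h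
  linear_combination h

/-- The conjugation `Y ↦ -Y - a₁ X - a₃` of the coordinate ring. -/
noncomputable def conj : W.CoordinateRing →ₐ[k[X]] W.CoordinateRing :=
  AdjoinRoot.liftAlgHom W.polynomial (Algebra.ofId k[X] W.CoordinateRing)
    (-mk W Y - algebraMap k[X] W.CoordinateRing W.linCoeff) (by
      have h := mk_Y_sq W
      simp only [linCoeff, cubic, map_add, map_mul, map_pow] at h
      simp only [polynomial, linCoeff, eval₂_sub, eval₂_add, eval₂_mul, eval₂_pow, eval₂_X,
        eval₂_C, map_add, map_mul, map_pow, RingHom.coe_coe, Algebra.ofId_apply]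
      linear_combination h)

theorem conj_mk_Y : conj W (mk W Y) = -mk W Y - algebraMap k[X] W.CoordinateRing W.linCoeff := by
  exact AdjoinRoot.liftAlgHom_root ..

theorem conj_conj (r : W.CoordinateRing) : conj W (conj W r) = r := by
  obtain ⟨a, b, rfl⟩ := exists_smul_basis_eq r
  simp only [map_add, map_smul, map_one, conj_mk_Y, map_sub, map_neg, AlgHom.commutes]
  congr 2
  ring

theorem conj_injective : Function.Injective (conj W) :=
  (show Function.Involutive (conj W) from conj_conj W).injective

variable {W}

theorem add_conj (a b : k[X]) :
    (a • (1 : W.CoordinateRing) + b • mk W Y) + conj W (a • 1 + b • mk W Y) =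
      algebraMap k[X] W.CoordinateRing (2 * a - b * W.linCoeff) := by
  simp only [map_add, map_smul, map_one, conj_mk_Y, map_sub, map_mul, map_ofNat]
  simp only [Algebra.smul_def]
  ring

theorem mul_conj (a b : k[X]) :
    (a • (1 : W.CoordinateRing) + b • mk W Y) * conj W (a • 1 + b • mk W Y) =
      algebraMap k[X] W.CoordinateRing (a ^ 2 - a * b * W.linCoeff - b ^ 2 * W.cubic) := by
  simp only [map_add, map_smul, map_one, conj_mk_Y, map_sub, map_mul, map_pow]
  simp only [Algebra.smul_def]
  linear_combination -(algebraMap k[X] W.CoordinateRing b) ^ 2 * mk_Y_sq W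

theorem mul_conj_eq_norm (r : W.CoordinateRing) :
    r * conj W r = algebraMap k[X] W.CoordinateRing (Algebra.norm k[X] r) := by
  obtain ⟨a, b, rfl⟩ := exists_smul_basis_eq r
  rw [mul_conj, norm_smul_basis, linCoeff, cubic]

instance : Module.Finite k[X] W.CoordinateRing := .of_basis (CoordinateRing.basis W)

theorem dvd_of_isIntegral_div {L : Type*} [Field L] [Algebra k[X] L] [FaithfulSMul k[X] L]
    {a d : k[X]} (hd : d ≠ 0)
    (h : _root_.IsIntegral k[X] (algebraMap k[X] L a / algebraMap k[X] L d)) : d ∣ a := by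
  let K := FractionRing k[X]
  let φ : K →ₐ[k[X]] L := IsFractionRing.liftAlgHom (g := Algebra.ofId k[X] L)
    (FaithfulSMul.algebraMap_injective k[X] L)
  have h' : _root_.IsIntegral k[X] (algebraMap k[X] K a / algebraMap k[X] K d) := by
    rw [← isIntegral_algHom_iff φ φ.toRingHom.injective]
    simpa using h
  obtain ⟨y, hy⟩ := IsIntegrallyClosed.isIntegral_iff.1 h'
  refine ⟨y, ?_⟩
  have hd' : algebraMap k[X] K d ≠ 0 := by simpa using hd
  rw [eq_div_iff hd', ← map_mul] at hy
  rw [← FaithfulSMul.algebraMap_injective k[X] K hy, mul_comm]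

/-- Integrality of `r / p` passes to its conjugate, hence to its trace and norm. As `k[X]` is
integrally closed, `p` divides the trace of `r` and `p ^ 2` divides its norm. -/
theorem exists_eq_smul_of_isIntegral_of_irreducible [W.IsElliptic] {p : k[X]} (hp : Irreducible p)
    (r : W.CoordinateRing)
    (h : _root_.IsIntegral k[X] (algebraMap W.CoordinateRing W.FunctionField r /
      algebraMap k[X] W.FunctionField p)) : ∃ r' : W.CoordinateRing, r = p • r' := by
  obtain ⟨σ, hσ⟩ := exists_extend_fractionRing (L := W.FunctionField) (conj W) (conj_injective W)
  have h' := h.map σ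
  rw [map_div₀, hσ, AlgHom.commutes] at h'
  obtain ⟨a, b, rfl⟩ := exists_smul_basis_eq r
  have hp0 : algebraMap k[X] W.FunctionField p ≠ 0 := by simpa using hp.ne_zero
  have ht := h.add h'
  rw [← add_div, ← map_add, add_conj, ← IsScalarTower.algebraMap_apply] at ht
  have hn := h.mul h'
  rw [div_mul_div_comm, ← map_mul, mul_conj, ← IsScalarTower.algebraMap_apply, ← map_mul] at hn
  obtain ⟨⟨a', rfl⟩, ⟨b', rfl⟩⟩ := dvd_of_dvd_trace_of_sq_dvd_norm hp
    (dvd_of_isIntegral_div hp.ne_zero ht)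
    (by rw [sq p]; exact dvd_of_isIntegral_div (mul_ne_zero hp.ne_zero hp.ne_zero) hn)
  exact ⟨a' • 1 + b' • mk W Y, by simp only [smul_add, smul_smul]⟩

theorem exists_eq_smul_of_isIntegral [W.IsElliptic] {d : k[X]} (hd : d ≠ 0) :
    ∀ r : W.CoordinateRing, _root_.IsIntegral k[X] (algebraMap W.CoordinateRing W.FunctionField r /
      algebraMap k[X] W.FunctionField d) → ∃ r' : W.CoordinateRing, r = d • r' := by
  induction d using WfDvdMonoid.induction_on_irreducible with
  | zero => exact absurd rfl hd
  | unit u hu =>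
    intro r _
    obtain ⟨u, rfl⟩ := hu
    exact ⟨((u⁻¹ : k[X]ˣ) : k[X]) • r, by rw [smul_smul, Units.mul_inv, one_smul]⟩
  | mul d p hd0 hp ih =>
    intro r hr
    have hp0 : algebraMap k[X] W.FunctionField p ≠ 0 := by simpa using hp.ne_zero
    have hd1 : algebraMap k[X] W.FunctionField d ≠ 0 := by simpa using hd0
    obtain ⟨r₁, rfl⟩ := exists_eq_smul_of_isIntegral_of_irreducible hp r (by
      have e : algebraMap W.CoordinateRing W.FunctionField r /
          algebraMap k[X] W.FunctionField p = algebraMap k[X] W.FunctionField d *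
          (algebraMap W.CoordinateRing W.FunctionField r /
          algebraMap k[X] W.FunctionField (p * d)) := by
        rw [map_mul]
        field_simp
      rw [e]
      exact (isIntegral_algebraMap (R := k[X]) (A := W.FunctionField) (x := d)).mul hr)
    obtain ⟨r₂, rfl⟩ := ih hd0 r₁ (by
      have e : algebraMap W.CoordinateRing W.FunctionField r₁ /
          algebraMap k[X] W.FunctionField d = algebraMap W.CoordinateRing W.FunctionField (p • r₁) /
          algebraMap k[X] W.FunctionField (p * d) := by
        rw [Algebra.smul_def, map_mul, map_mul, ← IsScalarTower.algebraMap_apply]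
        field_simp
      rw [e]
      exact hr)
    exact ⟨r₂, by rw [smul_smul]⟩

instance [W.IsElliptic] : IsIntegrallyClosed W.CoordinateRing := by
  rw [isIntegrallyClosed_iff W.FunctionField]
  intro z hz
  have hz' : _root_.IsIntegral k[X] z := isIntegral_trans z hz
  obtain ⟨r, s, hs, rfl⟩ := IsFractionRing.div_surjective W.CoordinateRing z
  have hs0 : s ≠ 0 := nonZeroDivisors.ne_zero hs
  have hc0 : conj W s ≠ 0 := by
    simpa using (conj_injective W).ne hs0
  have hn0 : Algebra.norm k[X] s ≠ 0 := by
    intro h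
    have := mul_conj_eq_norm s
    rw [h, map_zero] at this
    exact mul_ne_zero hs0 hc0 this
  have e0 : algebraMap W.CoordinateRing W.FunctionField s ≠ 0 := by simpa using hs0
  have e1 : algebraMap W.CoordinateRing W.FunctionField (conj W s) ≠ 0 := by simpa using hc0
  -- Multiplying by the conjugate of `s` makes the denominator a polynomial.
  have key : algebraMap W.CoordinateRing W.FunctionField r /
      algebraMap W.CoordinateRing W.FunctionField s =
      algebraMap W.CoordinateRing W.FunctionField (r * conj W s) /
      algebraMap k[X] W.FunctionField (Algebra.norm k[X] s) := by
    rw [IsScalarTower.algebraMap_apply k[X] W.CoordinateRing W.FunctionField,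
      ← mul_conj_eq_norm, map_mul, map_mul]
    field_simp
  rw [key] at hz' ⊢
  obtain ⟨r', hr'⟩ := exists_eq_smul_of_isIntegral hn0 _ hz'
  refine ⟨r', ?_⟩
  have hn1 : algebraMap k[X] W.FunctionField (Algebra.norm k[X] s) ≠ 0 := by simpa using hn0
  rw [hr', Algebra.smul_def, map_mul, ← IsScalarTower.algebraMap_apply]
  field_simp

instance : Ring.DimensionLEOne W.CoordinateRing where
  maximalOfPrime {P} hP0 hP := by
    have : (P.comap (algebraMap k[X] W.CoordinateRing)).IsMaximal :=
      (Ideal.IsPrime.comap (algebraMap k[X] W.CoordinateRing)).isMaximal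
        (Ideal.comap_ne_bot_of_integral_mem (R := k[X])
          (Submodule.exists_mem_ne_zero_of_ne_bot hP0).choose_spec.2
          (Submodule.exists_mem_ne_zero_of_ne_bot hP0).choose_spec.1
          (Algebra.IsIntegral.isIntegral _))
    exact Ideal.isMaximal_of_isIntegral_of_isMaximal_comap P this

instance [W.IsElliptic] : IsDedekindDomain W.CoordinateRing where

end CoordinateRing

end WeierstrassCurve.Affine

end

/-! ### The pole order at infinity on the coordinate ring -/

section

open Polynomial WithZero
open scoped Polynomial.Bivariate

namespace WeierstrassCurve.Affine.CoordinateRing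

variable {k : Type*} [Field k] {W : Affine k}

theorem norm_eq_zero_iff (r : W.CoordinateRing) : Algebra.norm k[X] r = 0 ↔ r = 0 := by
  constructor
  · intro h
    have h1 := mul_conj_eq_norm r
    rw [h, map_zero, mul_eq_zero] at h1
    rcases h1 with h1 | h1
    · exact h1
    · exact conj_injective W (by rw [h1, map_zero])
  · rintro rfl
    simp

theorem degree_lt_iff_coeff (a : k[X]) (n j : ℕ) :
    2 • a.degree + (j : WithBot ℕ) < n ↔ ∀ i, n ≤ 2 * i + j → a.coeff i = 0 := by
  rcases eq_or_ne a 0 with rfl | ha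
  · simp
  · rw [degree_eq_natDegree ha]
    have : 2 • (a.natDegree : WithBot ℕ) + (j : WithBot ℕ) < n ↔ 2 * a.natDegree + j < n := by
      rw [two_nsmul, two_mul]
      norm_cast
    rw [this]
    constructor
    · intro h i hi
      exact coeff_eq_zero_of_natDegree_lt (by omega)
    · intro h
      by_contra hn
      exact leadingCoeff_ne_zero.2 ha (h a.natDegree (by omega))

/-- The norm has degree `max (2 deg a) (2 deg b + 3)`: the parities differ, so leading terms never
cancel. A bound on it is thus a linear condition on coefficients, which is what makes `degreeLT` a
subspace and the pole order a valuation. -/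
theorem degree_norm_lt_iff (a b : k[X]) (n : ℕ) :
    (Algebra.norm k[X] (a • (1 : W.CoordinateRing) + b • mk W Y)).degree < n ↔
      (∀ i, n ≤ 2 * i → a.coeff i = 0) ∧ ∀ i, n ≤ 2 * i + 3 → b.coeff i = 0 := by
  rw [degree_norm_smul_basis, max_lt_iff, ← degree_lt_iff_coeff b n 3]
  have := degree_lt_iff_coeff a n 0
  simp only [Nat.cast_zero, add_zero] at this
  rw [this]
  rfl

/-- The elements of the coordinate ring whose pole order at infinity is less than `n`. -/
noncomputable def degreeLT (W : Affine k) (n : ℕ) : Submodule k W.CoordinateRing where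
  carrier := {r | (Algebra.norm k[X] r).degree < n}
  zero_mem' := by simp [(norm_eq_zero_iff (0 : W.CoordinateRing)).2 rfl]
  add_mem' := by
    intro r s hr hs
    obtain ⟨a, b, rfl⟩ := exists_smul_basis_eq r
    obtain ⟨c, d, rfl⟩ := exists_smul_basis_eq s
    have e : (a • (1 : W.CoordinateRing) + b • mk W Y) + (c • 1 + d • mk W Y) =
      (a + c) • 1 + (b + d) • mk W Y := by module
    rw [Set.mem_ofPred_eq, degree_norm_lt_iff] at hr hs
    rw [e, Set.mem_ofPred_eq, degree_norm_lt_iff]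
    exact ⟨fun i hi => by rw [coeff_add, hr.1 i hi, hs.1 i hi, add_zero],
      fun i hi => by rw [coeff_add, hr.2 i hi, hs.2 i hi, add_zero]⟩
  smul_mem' := by
    intro c r hr
    obtain ⟨a, b, rfl⟩ := exists_smul_basis_eq r
    have e : c • (a • (1 : W.CoordinateRing) + b • mk W Y) =
      (c • a) • 1 + (c • b) • mk W Y := by
      rw [smul_add, smul_assoc, smul_assoc]
    rw [Set.mem_ofPred_eq, degree_norm_lt_iff] at hr
    rw [e, Set.mem_ofPred_eq, degree_norm_lt_iff]
    exact ⟨fun i hi => by rw [coeff_smul, hr.1 i hi, smul_zero],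
      fun i hi => by rw [coeff_smul, hr.2 i hi, smul_zero]⟩

theorem mem_degreeLT {r : W.CoordinateRing} {n : ℕ} :
    r ∈ degreeLT W n ↔ (Algebra.norm k[X] r).degree < n := Iff.rfl

theorem mem_degreeLT_natDegree_add_one (r : W.CoordinateRing) :
    r ∈ degreeLT W ((Algebra.norm k[X] r).natDegree + 1) := by
  rw [mem_degreeLT]
  exact degree_le_natDegree.trans_lt (by exact_mod_cast Nat.lt_succ_self _)

theorem natDegree_lt_of_mem_degreeLT {r : W.CoordinateRing} {n : ℕ} (hr : r ≠ 0)
    (h : r ∈ degreeLT W n) : (Algebra.norm k[X] r).natDegree < n :=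
  (natDegree_lt_iff_degree_lt ((norm_eq_zero_iff r).not.2 hr)).2 h

/-- The pole order at infinity, as a valuation of the coordinate ring. -/
noncomputable def infValuation (W : Affine k) : Valuation W.CoordinateRing ℤᵐ⁰ where
  toFun r := open Classical in
    if r = 0 then 0 else exp ((Algebra.norm k[X] r).natDegree : ℤ)
  map_zero' := by simp
  map_one' := by simp
  map_mul' r s := by
    rcases eq_or_ne r 0 with rfl | hr
    · simp
    rcases eq_or_ne s 0 with rfl | hs
    · simp
    rw [if_neg hr, if_neg hs, if_neg (mul_ne_zero hr hs), map_mul, natDegree_mul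
      ((norm_eq_zero_iff r).not.2 hr) ((norm_eq_zero_iff s).not.2 hs), Nat.cast_add, exp_add]
  map_add_le_max' r s := by
    rcases eq_or_ne r 0 with rfl | hr
    · simp
    rcases eq_or_ne s 0 with rfl | hs
    · simp
    rcases eq_or_ne (r + s) 0 with hrs | hrs
    · simp [hrs]
    rw [if_neg hr, if_neg hs, if_neg hrs, le_max_iff, exp_le_exp, exp_le_exp]
    have mono : ∀ t : W.CoordinateRing, ∀ m, (Algebra.norm k[X] t).natDegree ≤ m →
        t ∈ degreeLT W (m + 1) := fun t m hm =>
      lt_of_lt_of_le (mem_degreeLT.1 (mem_degreeLT_natDegree_add_one t))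
        (by exact_mod_cast Nat.succ_le_succ hm)
    have h := natDegree_lt_of_mem_degreeLT hrs (add_mem (mono r _ (le_max_left _ _))
      (mono s _ (le_max_right _ _)))
    omega

theorem infValuation_apply {r : W.CoordinateRing} (hr : r ≠ 0) :
    infValuation W r = exp ((Algebra.norm k[X] r).natDegree : ℤ) := if_neg hr

theorem infValuation_lt_exp_iff (r : W.CoordinateRing) (n : ℕ) :
    infValuation W r < exp (n : ℤ) ↔ r ∈ degreeLT W n := by
  rcases eq_or_ne r 0 with rfl | hr
  · simp
  · rw [infValuation_apply hr, exp_lt_exp, mem_degreeLT,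
      ← natDegree_lt_iff_degree_lt ((norm_eq_zero_iff r).not.2 hr)]
    norm_cast

theorem infValuation_algebraMap (a : k[X]) (ha : a ≠ 0) :
    infValuation W (algebraMap k[X] W.CoordinateRing a) = exp ((2 * a.natDegree : ℕ) : ℤ) := by
  have e := norm_smul_basis (W' := W) a 0
  simp only [zero_smul, add_zero, mul_zero, zero_mul, sub_zero, ne_eq, OfNat.ofNat_ne_zero,
    not_false_eq_true, zero_pow] at e
  rw [infValuation_apply ((FaithfulSMul.algebraMap_injective k[X] W.CoordinateRing).ne_iff'
    (map_zero _) |>.2 ha), Algebra.algebraMap_eq_smul_one, e, natDegree_pow]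

theorem infValuation_mk_Y : infValuation W (mk W Y) = exp (3 : ℤ) := by
  have e := norm_smul_basis (W' := W) 0 1
  simp only [one_smul, zero_smul, zero_add] at e
  have h0 : mk W Y ≠ 0 := by
    rw [← basis_one]
    exact (CoordinateRing.basis W).ne_zero 1
  have h := degree_norm_smul_basis (W' := W) 0 1
  simp only [one_smul, zero_smul, zero_add] at h
  rw [infValuation_apply h0, natDegree_eq_of_degree_eq_some (n := 3)]
  · rfl
  · rw [h]
    simp

/-- Two elements with the same pole order at infinity have proportional leading terms. -/
theorem exists_infValuation_sub_smul_lt {r s : W.CoordinateRing} (hr : r ≠ 0)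
    (h : infValuation W r = infValuation W s) :
    ∃ c : k, infValuation W (r - c • s) < infValuation W r := by
  have hs : s ≠ 0 := by
    rintro rfl
    rw [map_zero, infValuation_apply hr] at h
    exact exp_ne_zero h
  set n := (Algebra.norm k[X] r).natDegree with hn
  have hr1 := mem_degreeLT_natDegree_add_one r
  have hs1 : s ∈ degreeLT W (n + 1) := by
    rw [infValuation_apply hr, infValuation_apply hs, exp_inj] at h
    convert mem_degreeLT_natDegree_add_one s using 2
    omega
  have hs2 : ¬ s ∈ degreeLT W n := by
    rw [← infValuation_lt_exp_iff, ← h, infValuation_apply hr]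
    exact lt_irrefl _
  rw [infValuation_apply hr, ← hn]
  simp only [infValuation_lt_exp_iff]
  obtain ⟨a, b, rfl⟩ := exists_smul_basis_eq r
  obtain ⟨a', b', rfl⟩ := exists_smul_basis_eq s
  rw [mem_degreeLT, degree_norm_lt_iff] at hr1 hs1 hs2
  have e : ∀ c : k, a • (1 : W.CoordinateRing) + b • mk W Y - c • (a' • 1 + b' • mk W Y) =
      (a - c • a') • 1 + (b - c • b') • mk W Y := fun c => by
    rw [sub_smul, sub_smul, smul_add, smul_assoc, smul_assoc]
    abel
  simp only [e, mem_degreeLT, degree_norm_lt_iff, coeff_sub, coeff_smul, smul_eq_mul]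
  rw [← hn] at hr1
  rw [not_and_or] at hs2
  push Not at hs2
  -- Exactly one coefficient carries the leading term: that of `X ^ i` with `2 i = n`, or that of `X
  -- ^ i Y` with `2 i + 3 = n`. The constant is the quotient of these coefficients.
  rcases hs2 with ⟨i, hi, hi0⟩ | ⟨i, hi, hi0⟩
  · have : ¬ n + 1 ≤ 2 * i := fun h => hi0 (hs1.1 i h)
    refine ⟨a.coeff i / a'.coeff i, fun j hj => ?_, fun j hj => ?_⟩
    · rcases eq_or_ne j i with rfl | hji
      · field_simp
        simp
      · rw [hr1.1 j (by omega), hs1.1 j (by omega)]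
        simp
    · rw [hr1.2 j (by omega), hs1.2 j (by omega)]
      simp
  · have : ¬ n + 1 ≤ 2 * i + 3 := fun h => hi0 (hs1.2 i h)
    refine ⟨b.coeff i / b'.coeff i, fun j hj => ?_, fun j hj => ?_⟩
    · rw [hr1.1 j (by omega), hs1.1 j (by omega)]
      simp
    · rcases eq_or_ne j i with rfl | hji
      · field_simp
        simp
      · rw [hr1.2 j (by omega), hs1.2 j (by omega)]
        simp

/-- The bounds count the `i` with `2 i ≤ n` and those with `2 i + 3 ≤ n`; truncated subtraction
gives the right value `0` for small `n`. -/
theorem smul_add_smul_mem_degreeLT {n : ℕ} {a b : k[X]}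
    (ha : a ∈ Polynomial.degreeLT k (n / 2 + 1)) (hb : b ∈ Polynomial.degreeLT k ((n - 1) / 2)) :
    a • (1 : W.CoordinateRing) + b • mk W Y ∈ degreeLT W (n + 1) := by
  rw [Polynomial.mem_degreeLT, degree_lt_iff_coeff_zero] at ha hb
  rw [mem_degreeLT, degree_norm_lt_iff]
  exact ⟨fun i hi => ha i (by omega), fun i hi => hb i (by omega)⟩

/-- The map `(a, b) ↦ a + b Y`, on pairs of polynomials of bounded degree. -/
noncomputable def toDegreeLT (W : Affine k) (n : ℕ) :
    (Polynomial.degreeLT k (n / 2 + 1) × Polynomial.degreeLT k ((n - 1) / 2)) →ₗ[k]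
      degreeLT W (n + 1) where
  toFun ab := ⟨(ab.1 : k[X]) • (1 : W.CoordinateRing) + (ab.2 : k[X]) • mk W Y,
    smul_add_smul_mem_degreeLT ab.1.2 ab.2.2⟩
  map_add' x y := by
    apply Subtype.ext
    simp only [Prod.fst_add, Prod.snd_add, Submodule.coe_add, add_smul]
    abel
  map_smul' c x := by
    apply Subtype.ext
    simp only [Prod.smul_fst, Prod.smul_snd, Submodule.coe_smul, smul_assoc, smul_add,
      RingHom.id_apply]

/-- Elements of pole order at most `n` are given by a pair of polynomials of bounded degree. -/
noncomputable def degreeLTEquiv (W : Affine k) (n : ℕ) :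
    (Polynomial.degreeLT k (n / 2 + 1) × Polynomial.degreeLT k ((n - 1) / 2)) ≃ₗ[k]
      degreeLT W (n + 1) :=
  LinearEquiv.ofBijective (toDegreeLT W n) (by
    constructor
    · rw [injective_iff_map_eq_zero]
      intro x hx
      have := smul_basis_eq_zero (congrArg Subtype.val hx)
      exact Prod.ext (Subtype.ext this.1) (Subtype.ext this.2)
    · rintro ⟨r, hr⟩
      obtain ⟨a, b, rfl⟩ := exists_smul_basis_eq r
      rw [mem_degreeLT, degree_norm_lt_iff] at hr
      refine ⟨⟨⟨a, ?_⟩, ⟨b, ?_⟩⟩, rfl⟩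
      · rw [Polynomial.mem_degreeLT, degree_lt_iff_coeff_zero]
        exact fun i hi => hr.1 i (by omega)
      · rw [Polynomial.mem_degreeLT, degree_lt_iff_coeff_zero]
        exact fun i hi => hr.2 i (by omega))

instance (n : ℕ) : FiniteDimensional k (Polynomial.degreeLT k n) :=
  Module.Finite.equiv (Polynomial.degreeLTEquiv k n).symm

/-- Riemann–Roch for `n·∞`. It fails for `n = 0`, where the constants have dimension one. -/
theorem finrank_degreeLT {n : ℕ} (hn : 1 ≤ n) :
    Module.finrank k (degreeLT W (n + 1)) = n := by
  rw [← (degreeLTEquiv W n).finrank_eq, Module.finrank_prod,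
    (Polynomial.degreeLTEquiv k _).finrank_eq, (Polynomial.degreeLTEquiv k _).finrank_eq,
    Module.finrank_fin_fun, Module.finrank_fin_fun]
  omega

end WeierstrassCurve.Affine.CoordinateRing

end

/-! ### The place at infinity and its uniqueness -/

section

open Polynomial WithZero
open scoped Polynomial.Bivariate

namespace FFPlace

variable {k F : Type*} [Field k] [Field F] [Algebra k F]

instance (x : FFPlace k F) : x.valuation.IsTrivialOn k where
  eq_one c hc := by
    have h0 : algebraMap k F c ≠ 0 := by simpa using hc
    exact (x.ord_eq_zero_iff h0).1 (x.ord_algebraMap hc)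

theorem eq_of_ring_le {x y : FFPlace k F} (h : x.ring ≤ y.ring) : x = y :=
  ext_ring (ValuationSubring.eq_of_le_of_ne_top _ h y.ring_ne_top)

end FFPlace

namespace WeierstrassCurve.Affine

open CoordinateRing

section Coordinates

variable {k : Type*} [Field k] (W : Affine k) (F : Type*) [Field F] [Algebra W.CoordinateRing F]
  [Algebra k F] [IsScalarTower k W.CoordinateRing F]

theorem algebraMap_algebraMap_eq_aeval (a : k[X]) :
    algebraMap W.CoordinateRing F (algebraMap k[X] W.CoordinateRing a) =
      aeval (algebraMap W.CoordinateRing F (algebraMap k[X] W.CoordinateRing X)) a := by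
  have : aeval (algebraMap k[X] W.CoordinateRing X) a = algebraMap k[X] W.CoordinateRing a := by
    rw [aeval_algebraMap_apply, aeval_X_left_apply]
  rw [aeval_algebraMap_apply, this]

variable {W} in
theorem natDegree_linCoeff_le : W.linCoeff.natDegree ≤ 1 := natDegree_linear_le

variable {W} in
theorem natDegree_cubic : W.cubic.natDegree = 3 := by
  have h := Polynomial.natDegree_cubic (R := k) (a := 1) (b := W.a₂) (c := W.a₄) (d := W.a₆)
    one_ne_zero
  simpa [cubic] using h

/-- The orders of the coordinate functions at a place where one of them has a pole. -/
theorem exists_valuation_coordinates (x : FFPlace k F)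
    (hx : ∃ r : W.CoordinateRing, algebraMap W.CoordinateRing F r ∉ x.ring) :
    ∃ e : ℤ, 0 < e ∧
      x.valuation (algebraMap W.CoordinateRing F (algebraMap k[X] W.CoordinateRing X)) =
        exp (2 * e) ∧ x.valuation (algebraMap W.CoordinateRing F (CoordinateRing.mk W Y)) = exp (3 * e) := by
  set t := algebraMap W.CoordinateRing F (algebraMap k[X] W.CoordinateRing X) with ht
  set y := algebraMap W.CoordinateRing F (CoordinateRing.mk W Y) with hy
  have hrel : y ^ 2 + aeval t W.linCoeff * y = aeval t W.cubic := by
    rw [ht, hy, ← algebraMap_algebraMap_eq_aeval, ← algebraMap_algebraMap_eq_aeval, ← mk_Y_sq]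
    simp only [map_add, map_mul, map_pow]
  have hpoly : x.valuation t ≤ 1 → ∀ a : k[X], x.valuation (aeval t a) ≤ 1 := by
    intro h a
    rw [aeval_eq_sum_range]
    refine x.valuation.map_sum_le fun i _ => ?_
    rw [Algebra.smul_def, map_mul, map_pow]
    exact mul_le_one' ((x.valuation_le_one_iff _).2 (x.algebraMap_mem _)) (pow_le_one' h i)
  -- If `t` had no pole, the Weierstrass equation, monic in `y`, would leave `y` without one, and
  -- then the whole coordinate ring would lie in the ring of `x`.
  have hgt : 1 < x.valuation t := by
    by_contra hle
    rw [not_lt] at hle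
    have hyle : x.valuation y ≤ 1 := by
      by_contra hyn
      rw [not_le] at hyn
      have h1 : x.valuation (aeval t W.linCoeff * y) < x.valuation (y ^ 2) := by
        rw [map_mul, map_pow, sq]
        exact mul_lt_mul_of_pos_right ((hpoly hle _).trans_lt hyn) (zero_lt_one.trans hyn)
      have h2 := x.valuation.map_add_eq_of_lt_left h1
      rw [hrel, map_pow] at h2
      exact absurd (hpoly hle W.cubic) (by rw [h2, not_le]; exact one_lt_pow₀ hyn two_ne_zero)
    obtain ⟨r, hr⟩ := hx
    apply hr
    obtain ⟨a, b, rfl⟩ := exists_smul_basis_eq r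
    rw [← x.valuation_le_one_iff, Algebra.smul_def, Algebra.smul_def, mul_one, map_add, map_mul,
      algebraMap_algebraMap_eq_aeval W F a, algebraMap_algebraMap_eq_aeval W F b]
    refine x.valuation.map_add_le (hpoly hle a) ?_
    rw [map_mul]
    exact mul_le_one' (hpoly hle b) hyle
  have hc0 : W.cubic ≠ 0 := by
    intro h
    have := natDegree_cubic (W := W)
    rw [h, natDegree_zero] at this
    omega
  have hcub : x.valuation (aeval t W.cubic) = x.valuation t ^ 3 := by
    rw [valuation_aeval_eq_valuation_X_pow_natDegree_of_one_lt_valuation_X t hgt hc0,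
      natDegree_cubic]
  have hlin : x.valuation (aeval t W.linCoeff) ≤ x.valuation t := by
    rcases eq_or_ne W.linCoeff 0 with h | h
    · rw [h]
      simp
    · rw [valuation_aeval_eq_valuation_X_pow_natDegree_of_one_lt_valuation_X t hgt h]
      exact (pow_le_pow_right₀ hgt.le natDegree_linCoeff_le).trans_eq (pow_one _)
  -- Otherwise the left side of the Weierstrass equation has a pole of order at most that of `t ^
  -- 2`, while the cubic has that of `t ^ 3`.
  have hty : x.valuation t < x.valuation y := by
    by_contra hle
    rw [not_lt] at hle
    have h1 : x.valuation (y ^ 2 + aeval t W.linCoeff * y) ≤ x.valuation t ^ 2 := by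
      refine x.valuation.map_add_le ?_ ?_
      · rw [map_pow]
        exact pow_le_pow_left₀ zero_le hle 2
      · rw [map_mul, sq]
        exact mul_le_mul' hlin hle
    rw [hrel, hcub] at h1
    exact absurd h1 (by rw [not_le]; exact pow_lt_pow_right₀ hgt (by norm_num))
  have hyy : x.valuation y ^ 2 = x.valuation t ^ 3 := by
    have h1 : x.valuation (aeval t W.linCoeff * y) < x.valuation (y ^ 2) := by
      rw [map_mul, map_pow, sq]
      exact mul_lt_mul_of_pos_right (hlin.trans_lt hty) (zero_le.trans_lt hty)
    rw [← map_pow, ← x.valuation.map_add_eq_of_lt_left h1, hrel, hcub]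
  have ht0 : x.valuation t ≠ 0 := (zero_lt_one.trans hgt).ne'
  have hy0 : x.valuation y ≠ 0 := (zero_le.trans_lt hty).ne'
  rw [← exp_log ht0, ← exp_zero, exp_lt_exp] at hgt
  rw [← exp_log ht0, ← exp_log hy0, ← exp_nsmul, ← exp_nsmul, exp_inj] at hyy
  simp only [nsmul_eq_mul, Nat.cast_ofNat] at hyy
  -- Twice the pole order of `y` is three times that of `t`, so their difference is the common
  -- factor `e`.
  refine ⟨log (x.valuation y) - log (x.valuation t), by omega, ?_, ?_⟩
  · rw [← exp_log ht0, exp_inj, log_exp]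
    omega
  · rw [← exp_log hy0, exp_inj, log_exp]
    omega

/-- Again `2 deg a` and `2 deg b + 3` differ, so the larger term of `a + b Y` decides. The valuation
is thus a positive multiple of the pole order at infinity and has the same valuation ring. -/
theorem valuation_algebraMap_of_coordinates (x : FFPlace k F) {e : ℤ} (he : 0 < e)
    (hX : x.valuation (algebraMap W.CoordinateRing F (algebraMap k[X] W.CoordinateRing X)) =
      exp (2 * e)) (hY : x.valuation (algebraMap W.CoordinateRing F (CoordinateRing.mk W Y)) = exp (3 * e))
    {r : W.CoordinateRing} (hr : r ≠ 0) :
    x.valuation (algebraMap W.CoordinateRing F r) =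
      exp (e * ((Algebra.norm k[X] r).natDegree : ℤ)) := by
  set t := algebraMap W.CoordinateRing F (algebraMap k[X] W.CoordinateRing X) with ht
  have hgt : 1 < x.valuation t := by
    rw [hX, ← exp_zero, exp_lt_exp]
    omega
  have hpol : ∀ {a : k[X]}, a ≠ 0 → x.valuation (aeval t a) = exp (e * (2 * a.natDegree : ℤ)) := by
    intro a ha
    rw [valuation_aeval_eq_valuation_X_pow_natDegree_of_one_lt_valuation_X t hgt ha, hX,
      ← exp_nsmul]
    congr 1
    simp only [nsmul_eq_mul]
    ring
  obtain ⟨a, b, rfl⟩ := exists_smul_basis_eq r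
  have hdeg := degree_norm_smul_basis (W' := W) a b
  have hsplit : algebraMap W.CoordinateRing F (a • 1 + b • CoordinateRing.mk W Y) =
      aeval t a + aeval t b * algebraMap W.CoordinateRing F (CoordinateRing.mk W Y) := by
    rw [Algebra.smul_def, Algebra.smul_def, mul_one, map_add, map_mul,
      algebraMap_algebraMap_eq_aeval W F a, algebraMap_algebraMap_eq_aeval W F b]
  rw [hsplit]
  have hb1 : b ≠ 0 → x.valuation (aeval t b * algebraMap W.CoordinateRing F (CoordinateRing.mk W Y)) =
      exp (e * (2 * b.natDegree + 3 : ℤ)) := by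
    intro hb
    rw [map_mul, hpol hb, hY, ← exp_add]
    congr 1
    ring
  rcases eq_or_ne a 0 with rfl | ha <;> rcases eq_or_ne b 0 with rfl | hb
  · simp at hr
  · rw [degree_eq_natDegree hb] at hdeg
    have hdeg' := natDegree_eq_of_degree_eq_some (n := 2 * b.natDegree + 3)
      (hdeg.trans (by simp [two_mul]))
    rw [map_zero, zero_add, hb1 hb, hdeg']
    push_cast
    rfl
  · rw [degree_eq_natDegree ha] at hdeg
    have hdeg' := natDegree_eq_of_degree_eq_some (n := 2 * a.natDegree)
      (hdeg.trans (by simp [two_mul]))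
    rw [map_zero, zero_mul, add_zero, hpol ha, hdeg']
    push_cast
    rfl
  · rw [degree_eq_natDegree ha, degree_eq_natDegree hb] at hdeg
    have hdeg' : (Algebra.norm k[X] (a • (1 : W.CoordinateRing) + b • CoordinateRing.mk W Y)).natDegree =
        max (2 * a.natDegree) (2 * b.natDegree + 3) := by
      apply natDegree_eq_of_degree_eq_some
      rw [hdeg]
      simp only [two_nsmul, two_mul]
      norm_cast
    rw [hdeg']
    rcases lt_or_gt_of_ne (show 2 * a.natDegree ≠ 2 * b.natDegree + 3 by omega) with h | h
    · rw [x.valuation.map_add_eq_of_lt_right, hb1 hb, max_eq_right h.le]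
      · push_cast; rfl
      · rw [hpol ha, hb1 hb, exp_lt_exp]
        exact mul_lt_mul_of_pos_left (by exact_mod_cast h) he
    · rw [x.valuation.map_add_eq_of_lt_left, hpol ha, max_eq_left h.le]
      · push_cast; rfl
      · rw [hpol ha, hb1 hb, exp_lt_exp]
        exact mul_lt_mul_of_pos_left (by exact_mod_cast h) he

end Coordinates

variable {k : Type*} [Field k] (W : Affine k) (F : Type*) [Field F] [Algebra W.CoordinateRing F]
  [IsFractionRing W.CoordinateRing F]

/-- The pole order at infinity, as a valuation of the function field. -/
noncomputable def infFieldValuation : Valuation F ℤᵐ⁰ :=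
  (infValuation W).extendToLocalization (S := nonZeroDivisors W.CoordinateRing) (by
    intro r hr
    have h0 : r ≠ 0 := nonZeroDivisors.ne_zero hr
    show infValuation W r ≠ 0
    rw [infValuation_apply h0]
    exact exp_ne_zero) F

theorem infFieldValuation_algebraMap (r : W.CoordinateRing) :
    infFieldValuation W F (algebraMap W.CoordinateRing F r) = infValuation W r :=
  Valuation.extendToLocalization_apply_map_apply ..

theorem infFieldValuation_surjective : Function.Surjective (infFieldValuation W F) := by
  intro g
  rcases eq_or_ne g 0 with rfl | hg
  · exact ⟨0, map_zero _⟩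
  -- The function `Y / X` has a pole of order `3 - 2 = 1`.
  refine ⟨(algebraMap W.CoordinateRing F (CoordinateRing.mk W Y) / algebraMap W.CoordinateRing F
    (algebraMap k[X] W.CoordinateRing X)) ^ log g, ?_⟩
  rw [map_zpow₀, map_div₀, infFieldValuation_algebraMap, infFieldValuation_algebraMap,
    infValuation_mk_Y, infValuation_algebraMap _ X_ne_zero, natDegree_X, ← exp_sub, ← exp_zsmul]
  norm_num [exp_log hg]

variable [Algebra k F] [IsScalarTower k W.CoordinateRing F]

theorem infFieldValuation_algebraMap_le_one (c : k) :
    infFieldValuation W F (algebraMap k F c) ≤ 1 := by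
  rcases eq_or_ne c 0 with rfl | hc
  · simp
  · rw [IsScalarTower.algebraMap_apply k W.CoordinateRing F, infFieldValuation_algebraMap,
      IsScalarTower.algebraMap_apply k k[X] W.CoordinateRing,
      infValuation_algebraMap _ (by simpa using hc)]
    simp

/-- The place at infinity of the function field of a Weierstrass curve. -/
noncomputable def infPlace : FFPlace k F :=
  FFPlace.ofValuation (infFieldValuation W F) (infFieldValuation_surjective W F)
    (infFieldValuation_algebraMap_le_one W F)

theorem valuation_infPlace (f : F) : (infPlace W F).valuation f = infFieldValuation W F f :=
  FFPlace.valuation_ofValuation ..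

theorem valuation_infPlace_algebraMap (r : W.CoordinateRing) :
    (infPlace W F).valuation (algebraMap W.CoordinateRing F r) = infValuation W r := by
  rw [valuation_infPlace, infFieldValuation_algebraMap]

/-- Both sides measure the degree of the norm. This is the product formula: the quotient by `r`
counts the affine zeros of `r` with multiplicity. -/
theorem ord_infPlace_algebraMap {r : W.CoordinateRing} (hr : r ≠ 0) :
    (infPlace W F).ord (algebraMap W.CoordinateRing F r) =
      -(Module.finrank k (W.CoordinateRing ⧸ Ideal.span {r}) : ℤ) := by
  rw [FFPlace.ord_def, valuation_infPlace_algebraMap, infValuation_apply hr, log_exp,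
    finrank_quotient_span_eq_natDegree_norm (CoordinateRing.basis W) hr]

theorem neg_lt_ord_infPlace_iff {r : W.CoordinateRing} (hr : r ≠ 0) (n : ℕ) :
    -(n : ℤ) < (infPlace W F).ord (algebraMap W.CoordinateRing F r) ↔ r ∈ degreeLT W n := by
  have h0 : algebraMap W.CoordinateRing F r ≠ 0 := by simpa using hr
  rw [← infValuation_lt_exp_iff, ← valuation_infPlace_algebraMap W F, FFPlace.valuation_eq_exp _ h0,
    exp_lt_exp]
  omega

theorem deg_infPlace : (infPlace W F).deg = 1 := by
  refine FFPlace.deg_eq_one _ fun f hf => ?_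
  rw [← FFPlace.valuation_le_one_iff] at hf
  rcases hf.lt_or_eq with hf | hf
  · exact ⟨0, by simpa using hf⟩
  obtain ⟨r, s, hs, rfl⟩ := IsFractionRing.div_surjective W.CoordinateRing f
  have hs0 : s ≠ 0 := nonZeroDivisors.ne_zero hs
  have hs1 : algebraMap W.CoordinateRing F s ≠ 0 := by simpa using hs0
  have hs2 : (infPlace W F).valuation (algebraMap W.CoordinateRing F s) ≠ 0 := by
    simpa using hs0
  have hr0 : r ≠ 0 := by
    rintro rfl
    simp at hf
  rw [map_div₀, div_eq_one_iff_eq hs2, valuation_infPlace_algebraMap,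
    valuation_infPlace_algebraMap] at hf
  obtain ⟨c, hc⟩ := exists_infValuation_sub_smul_lt hr0 hf
  refine ⟨c, ?_⟩
  have e : algebraMap W.CoordinateRing F r / algebraMap W.CoordinateRing F s - algebraMap k F c =
      algebraMap W.CoordinateRing F (r - c • s) / algebraMap W.CoordinateRing F s := by
    rw [map_sub, Algebra.smul_def, map_mul, ← IsScalarTower.algebraMap_apply]
    field_simp
  rw [e, map_div₀, div_lt_one₀ (zero_lt_iff.2 hs2), valuation_infPlace_algebraMap,
    valuation_infPlace_algebraMap, ← hf]
  exact hc

/-- The place at infinity is the only place that does not contain the coordinate ring. -/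
theorem eq_infPlace (x : FFPlace k F)
    (hx : ∃ r : W.CoordinateRing, algebraMap W.CoordinateRing F r ∉ x.ring) :
    x = infPlace W F := by
  obtain ⟨e, he, hX, hY⟩ := exists_valuation_coordinates W F x hx
  refine (FFPlace.eq_of_ring_le fun f hf => ?_).symm
  rw [← FFPlace.valuation_le_one_iff] at hf ⊢
  obtain ⟨r, s, hs, rfl⟩ := IsFractionRing.div_surjective W.CoordinateRing f
  have hs0 : s ≠ 0 := nonZeroDivisors.ne_zero hs
  rcases eq_or_ne r 0 with rfl | hr0
  · simp
  rw [map_div₀, valuation_infPlace_algebraMap, valuation_infPlace_algebraMap,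
    infValuation_apply hr0, infValuation_apply hs0, ← exp_sub, ← exp_zero, exp_le_exp] at hf
  rw [map_div₀, valuation_algebraMap_of_coordinates W F x he hX hY hr0,
    valuation_algebraMap_of_coordinates W F x he hX hY hs0, ← exp_sub, ← exp_zero, exp_le_exp,
    ← mul_sub]
  exact mul_nonpos_of_nonneg_of_nonpos he.le hf

end WeierstrassCurve.Affine

end

/-! ### Dimensions of quotients of a Dedekind domain, and its primes as places -/

section

open WithZero IsDedekindDomain

namespace Ring.HasFiniteQuotients

theorem polynomial (k : Type*) [Field k] [Finite k] :
    Ring.HasFiniteQuotients (Polynomial k) where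
  finiteQuotient {I} hI := by
    obtain ⟨f, rfl⟩ := (IsPrincipalIdealRing.principal I).principal
    have hf : f ≠ 0 := by
      rintro rfl
      simp at hI
    have : Module.Finite k (AdjoinRoot f) := (AdjoinRoot.powerBasis hf).finite
    exact Module.finite_of_finite k (M := AdjoinRoot f)

end Ring.HasFiniteQuotients

section Dedekind

theorem cardQuot_eq_pow_finrank (k : Type*) {R : Type*} [Field k] [CommRing R] [Algebra k R]
    [Ring.HasFiniteQuotients R] {I : Ideal R} (hI : I ≠ ⊥) :
    Submodule.cardQuot I = Nat.card k ^ Module.finrank k (R ⧸ I) := by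
  have : Finite (R ⧸ I) := Ring.HasFiniteQuotients.finiteQuotient hI
  rw [Submodule.cardQuot_apply, Module.natCard_eq_pow_finrank (K := k)]

theorem finrank_quotient_one (k R : Type*) [Field k] [CommRing R] [Algebra k R] :
    Module.finrank k (R ⧸ (1 : Ideal R)) = 0 := by
  have : Subsingleton (R ⧸ (1 : Ideal R)) := by
    rw [Ideal.one_eq_top]
    infer_instance
  exact Module.finrank_zero_of_subsingleton

variable {R : Type*} [CommRing R] [IsDedekindDomain R]

/-- Unique factorisation reduces to prime powers and coprime ideals. Infinitude makes the index of
the zero ideal `0`, so that case is multiplicative too. -/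
theorem cardQuot_mul_of_infinite [Infinite R] (I J : Ideal R) :
    Submodule.cardQuot (I * J) = Submodule.cardQuot I * Submodule.cardQuot J :=
  UniqueFactorizationMonoid.multiplicative_of_coprime Submodule.cardQuot I J
    (Submodule.cardQuot_bot _ _)
    (fun {I J} hI => by simp [Ideal.isUnit_iff.mp hI, Ideal.mul_top])
    (fun {I} i hI =>
      have : Ideal.IsPrime I := Ideal.isPrime_of_prime hI
      cardQuot_pow_of_prime hI.ne_zero)
    fun {I J} hIJ => cardQuot_mul_of_coprime <| Ideal.isCoprime_iff_sup_eq.mpr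
      (Ideal.isUnit_iff.mp
        (hIJ (Ideal.dvd_iff_le.mpr le_sup_left) (Ideal.dvd_iff_le.mpr le_sup_right)))

variable (k : Type*) [Field k] [Finite k] [Algebra k R]

theorem finrank_quotient_mul [Ring.HasFiniteQuotients R] [Infinite R] {I J : Ideal R} (hI : I ≠ ⊥)
    (hJ : J ≠ ⊥) : Module.finrank k (R ⧸ I * J) =
      Module.finrank k (R ⧸ I) + Module.finrank k (R ⧸ J) := by
  have h := cardQuot_mul_of_infinite I J
  rw [cardQuot_eq_pow_finrank k hI, cardQuot_eq_pow_finrank k hJ,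
    cardQuot_eq_pow_finrank k (mul_ne_zero hI hJ), ← pow_add] at h
  exact Nat.pow_right_injective Finite.one_lt_card h

theorem finrank_quotient_finsuppProd [Ring.HasFiniteQuotients R] [Infinite R]
    (E : HeightOneSpectrum R →₀ ℕ) :
    Module.finrank k (R ⧸ E.prod fun v n => v.asIdeal ^ n) =
      E.sum fun v n => n * Module.finrank k (R ⧸ v.asIdeal) := by
  have hpow : ∀ (v : HeightOneSpectrum R) (n : ℕ), v.asIdeal ^ n ≠ ⊥ :=
    fun v n => pow_ne_zero n v.ne_bot
  induction E using Finsupp.induction_linear with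
  | zero =>
    simp only [Finsupp.prod_zero_index, Finsupp.sum_zero_index]
    exact finrank_quotient_one k R
  | add D E hD hE =>
    rw [Finsupp.prod_add_index' (fun v => pow_zero _) (fun v => pow_add _),
      Finsupp.sum_add_index' (fun v => zero_mul _) (fun v => fun a b => add_mul _ _ _),
      finrank_quotient_mul k, hD, hE]
    · exact Finset.prod_ne_zero_iff.2 fun v _ => hpow v _
    · exact Finset.prod_ne_zero_iff.2 fun v _ => hpow v _
  | single v n =>
    rw [Finsupp.prod_single_index (h := fun (v : HeightOneSpectrum R) (n : ℕ) => v.asIdeal ^ n)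
        (pow_zero _), Finsupp.sum_single_index (zero_mul _)]
    induction n with
    | zero =>
      rw [pow_zero, zero_mul]
      exact finrank_quotient_one k R
    | succ n ih => rw [pow_succ, finrank_quotient_mul k (hpow v n) v.ne_bot, ih, add_one_mul]

/-- The multiplicities of a nonzero ideal of a Dedekind domain, as a finitely supported function,
compute the dimension of its quotient. -/
theorem exists_finsupp_multiplicity [Ring.HasFiniteQuotients R] [Infinite R] {I : Ideal R}
    (hI : I ≠ ⊥) : ∃ E : HeightOneSpectrum R →₀ ℕ, (∀ v, E v = multiplicity v.asIdeal I) ∧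
      Module.finrank k (R ⧸ I) = E.sum fun v n => n * Module.finrank k (R ⧸ v.asIdeal) := by
  induction I using UniqueFactorizationMonoid.induction_on_prime with
  | h₁ => exact absurd rfl hI
  | h₂ I hu =>
    have hI1 : I = 1 := (Ideal.isUnit_iff.1 hu).trans Ideal.one_eq_top.symm
    subst hI1
    refine ⟨0, fun v => ?_, ?_⟩
    · rw [Finsupp.zero_apply, eq_comm, multiplicity_eq_zero]
      · intro h
        exact v.prime.not_isUnit (isUnit_of_dvd_one h)
    · rw [Finsupp.sum_zero_index]
      exact finrank_quotient_one k R
  | h₃ J P hJ hP ih =>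
    obtain ⟨E, hE, hs⟩ := ih hJ
    have : P.IsPrime := Ideal.isPrime_of_prime hP
    let w : HeightOneSpectrum R := ⟨P, this, hP.ne_zero⟩
    refine ⟨Finsupp.single w 1 + E, fun v => ?_, ?_⟩
    · rw [multiplicity_mul v.prime (FiniteMultiplicity.of_prime_left v.prime hI), ← hE,
        Finsupp.add_apply]
      congr 1
      by_cases hvw : w = v
      · subst hvw
        rw [Finsupp.single_eq_same]
        exact (multiplicity_self).symm
      · rw [Finsupp.single_eq_of_ne' hvw, eq_comm, multiplicity_eq_zero]
        · intro h
          apply hvw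
          apply HeightOneSpectrum.ext
          exact ((w.isMaximal).eq_of_le v.isPrime.ne_top (Ideal.dvd_iff_le.1 h))
    · rw [Finsupp.sum_add_index' (fun v => zero_mul _) (fun v => fun a b => add_mul _ _ _),
        Finsupp.sum_single_index (zero_mul _), ← hs, finrank_quotient_mul k hP.ne_zero hJ, one_mul]

end Dedekind

namespace FFPlace

variable {k R F : Type*} [Field k] [CommRing R] [IsDedekindDomain R] [Field F] [Algebra k R]
  [Algebra k F] [Algebra R F] [IsScalarTower k R F] [IsFractionRing R F]

variable (k F) in
/-- The place attached to a nonzero prime ideal of a Dedekind domain with fraction field `F`. -/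
noncomputable def ofPrime (v : HeightOneSpectrum R) : FFPlace k F :=
  ofValuation (v.valuation F) (v.valuation_surjective F) fun c => by
    rw [IsScalarTower.algebraMap_apply k R F]
    exact v.valuation_le_one _

theorem valuation_ofPrime (v : HeightOneSpectrum R) (f : F) :
    (ofPrime k F v).valuation f = v.valuation F f :=
  valuation_ofValuation ..

theorem algebraMap_mem_ofPrime (v : HeightOneSpectrum R) (r : R) :
    algebraMap R F r ∈ (ofPrime k F v).ring :=
  v.valuation_le_one r

variable (k R F) in
theorem ofPrime_injective : Function.Injective (ofPrime k F : HeightOneSpectrum R → FFPlace k F) :=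
  fun v w h => HeightOneSpectrum.eq_of_valuation_isEquiv_valuation (K := F) (by
    rw [Valuation.isEquiv_iff_val_le_one]
    intro f
    rw [← valuation_ofPrime (k := k), ← valuation_ofPrime (k := k), h])

theorem ord_ofPrime_algebraMap (v : HeightOneSpectrum R) {r : R} (hr : r ≠ 0) :
    (ofPrime k F v).ord (algebraMap R F r) = multiplicity v.asIdeal (Ideal.span {r}) := by
  rw [ord_def, valuation_ofPrime, HeightOneSpectrum.valuation_of_algebraMap,
    v.intValuation_eq_exp_neg_multiplicity hr, log_exp, neg_neg]

/-- A place that contains `R` comes from a nonzero prime ideal of `R`. -/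
theorem exists_eq_ofPrime (x : FFPlace k F) (hx : ∀ r : R, algebraMap R F r ∈ x.ring) :
    ∃ v : HeightOneSpectrum R, ofPrime k F v = x := by
  let g : R →+* x.ring := (algebraMap R F).codRestrict x.ring.toSubring hx
  let P : Ideal R := (IsLocalRing.maximalIdeal x.ring).comap g
  have hP : P.IsPrime := Ideal.IsPrime.comap g
  have hmem : ∀ r, r ∈ P ↔ x.valuation (algebraMap R F r) < 1 := fun r =>
    (x.valuation_lt_one_iff (g r)).symm
  have hle : ∀ r, x.valuation (algebraMap R F r) ≤ 1 := fun r =>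
    (x.valuation_le_one_iff _).2 (hx r)
  have heq : ∀ r, r ∉ P → x.valuation (algebraMap R F r) = 1 := fun r hr =>
    le_antisymm (hle r) (not_lt.1 ((hmem r).not.1 hr))
  -- If `P` were zero, all nonzero elements of `R` would be units at `x`, and the ring of `x` would
  -- be all of `F`.
  have hP0 : P ≠ ⊥ := by
    intro h0
    apply x.ring_ne_top
    rw [eq_top_iff]
    intro f _
    obtain ⟨r, s, hs, rfl⟩ := IsFractionRing.div_surjective R f
    rw [← x.valuation_le_one_iff, map_div₀, heq s, div_one]
    · exact hle r
    · rw [h0, Ideal.mem_bot]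
      exact nonZeroDivisors.ne_zero hs
  refine ⟨⟨P, hP, hP0⟩, eq_of_ring_le fun f hf => ?_⟩
  rw [← valuation_le_one_iff, valuation_ofPrime] at hf
  obtain ⟨n, ⟨d, hd⟩, hnd⟩ := HeightOneSpectrum.exists_primeCompl_mul_eq_of_integer _ f hf
  rw [← valuation_le_one_iff]
  have h1 := congrArg x.valuation hnd
  rw [map_mul, heq d hd, mul_one] at h1
  rw [h1]
  exact hle n

theorem deg_ofPrime (v : HeightOneSpectrum R) :
    (ofPrime k F v).deg = Module.finrank k (R ⧸ v.asIdeal) := by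
  refine deg_eq_finrank_quotient _ v.asIdeal (algebraMap_mem_ofPrime v) (fun r => ?_) fun f hf => ?_
  · rw [valuation_ofPrime, v.valuation_lt_one_iff_mem]
  · rw [← valuation_le_one_iff, valuation_ofPrime] at hf
    obtain ⟨r, hr⟩ := v.exists_valuation_sub_lt_of_integer hf 1
    refine ⟨r, ?_⟩
    rw [valuation_ofPrime, Valuation.map_sub_swap]
    exact hr

end FFPlace

end

/-! ### Divisors on an elliptic model and existence of effective representatives -/

section

open WithZero IsDedekindDomain

namespace FFPlace

variable {k F : Type*} [Field k] [Field F] [Algebra k F]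

/-- The elements of `R` with a pole of order at most `n` at a place. -/
def poleSpace (R : Type*) [CommRing R] [Algebra k R] [Algebra R F] [IsScalarTower k R F]
    (x : FFPlace k F) (n : ℤ) : Submodule k R where
  carrier := {r | x.valuation (algebraMap R F r) ≤ exp n}
  zero_mem' := by simp
  add_mem' {r s} hr hs := by
    rw [Set.mem_ofPred_eq, map_add]
    exact x.valuation.map_add_le hr hs
  smul_mem' c r hr := by
    rw [Set.mem_ofPred_eq, Algebra.smul_def, map_mul, ← IsScalarTower.algebraMap_apply, map_mul]
    exact (mul_le_of_le_one_left' ((x.valuation_le_one_iff _).2 (x.algebraMap_mem c))).trans hr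

theorem mem_poleSpace {R : Type*} [CommRing R] [IsDomain R] [Algebra k R] [Algebra R F]
    [IsScalarTower k R F] [IsFractionRing R F] (x : FFPlace k F) (n : ℤ) {r : R} (hr : r ≠ 0) :
    r ∈ x.poleSpace R n ↔ -n ≤ x.ord (algebraMap R F r) := by
  have h0 : algebraMap R F r ≠ 0 := by simpa using hr
  show x.valuation (algebraMap R F r) ≤ exp n ↔ _
  rw [x.valuation_eq_exp h0, exp_le_exp]
  omega

end FFPlace

namespace FFDivisor

variable {k F : Type*} [Field k] [Field F] [Algebra k F]

theorem deg_single (x : FFPlace k F) (n : ℤ) :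
    FFDivisor.deg k F (Finsupp.single x n) = n * x.deg := by
  simp [FFDivisor.deg]

theorem deg_eq_sum (D : FFDivisor k F) : FFDivisor.deg k F D = D.sum fun x n => n * (x.deg : ℤ) :=
  rfl

theorem deg_nonneg {D : FFDivisor k F} (hD : 0 ≤ D) : 0 ≤ FFDivisor.deg k F D := by
  rw [deg_eq_sum]
  exact Finset.sum_nonneg fun x _ => mul_nonneg (hD x) (Nat.cast_nonneg _)

theorem eq_zero_or_exists_single_add {D : FFDivisor k F} (hD : 0 ≤ D) :
    D = 0 ∨ ∃ (x : FFPlace k F) (E : FFDivisor k F), 0 ≤ E ∧ D = Finsupp.single x 1 + E := by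
  rcases eq_or_ne D 0 with h0 | h0
  · exact Or.inl h0
  · obtain ⟨x, hx⟩ := Finsupp.ne_iff.1 h0
    refine Or.inr ⟨x, D - Finsupp.single x 1, fun y => ?_, by abel⟩
    have hy := hD y
    have hxx := hD x
    simp only [Finsupp.coe_zero, Pi.zero_apply, Finsupp.coe_sub, Pi.sub_apply] at hy hx hxx ⊢
    rcases eq_or_ne y x with rfl | hyx
    · rw [Finsupp.single_eq_same]
      omega
    · rw [Finsupp.single_eq_of_ne hyx]
      omega

variable (k) in
open Classical in
/-- The divisor of a function (zero, should the function have infinitely many zeros or poles). -/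
noncomputable def div (f : F) : FFDivisor k F :=
  if h : ∃ D : FFDivisor k F, ∀ x, D x = x.ord f then h.choose else 0

end FFDivisor

/-- The properties of the affine coordinate ring `R` of an elliptic curve and of the place at
infinity that determine the number of effective divisors in each class. -/
structure IsEllipticModel (k R F : Type*) [Field k] [CommRing R] [Field F] [Algebra k R]
    [Algebra k F] [Algebra R F] [IsScalarTower k R F] (inf : FFPlace k F) : Prop where
  deg_inf : inf.deg = 1
  eq_inf : ∀ x : FFPlace k F, (∃ r : R, algebraMap R F r ∉ x.ring) → x = inf
  ord_inf : ∀ r : R, r ≠ 0 →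
    inf.ord (algebraMap R F r) = -(Module.finrank k (R ⧸ Ideal.span {r}) : ℤ)
  finrank_poleSpace : ∀ n : ℕ, 1 ≤ n → Module.finrank k (inf.poleSpace R n) = n

set_option linter.unusedSectionVars false

namespace IsEllipticModel

open FFPlace FFDivisor

variable {k R F : Type*} [Field k] [CommRing R] [IsDedekindDomain R] [Field F] [Algebra k R] [Algebra k F] [Algebra R F]
  [IsScalarTower k R F] [IsFractionRing R F] {inf : FFPlace k F}

/-- A nonzero element of `v` vanishes at `v`, but no nonzero element of `R` vanishes at infinity. -/
theorem ofPrime_ne (h : IsEllipticModel k R F inf) (v : HeightOneSpectrum R) :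
    ofPrime k F v ≠ inf := by
  intro hv
  obtain ⟨r, hr, hr0⟩ := Submodule.exists_mem_ne_zero_of_ne_bot v.ne_bot
  have h0 : algebraMap R F r ≠ 0 := by simpa using hr0
  have h1 := h.ord_inf r hr0
  have h2 : 0 < inf.ord (algebraMap R F r) := by
    rw [← hv, ord_pos_iff _ h0, valuation_ofPrime, v.valuation_lt_one_iff_mem]
    exact hr
  omega

theorem finite_poleSpace (h : IsEllipticModel k R F inf) {n : ℕ} (hn : 1 ≤ n) :
    Module.Finite k (inf.poleSpace R n) :=
  Module.finite_of_finrank_pos (by rw [h.finrank_poleSpace n hn]; exact hn)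

theorem eq_inf_or_exists (h : IsEllipticModel k R F inf) (x : FFPlace k F) :
    x = inf ∨ ∃ v : HeightOneSpectrum R, ofPrime k F v = x := by
  by_cases hx : ∃ r : R, algebraMap R F r ∉ x.ring
  · exact Or.inl (h.eq_inf x hx)
  · push Not at hx
    exact Or.inr (exists_eq_ofPrime x hx)

variable (R) in
/-- The affine part of a divisor. -/
noncomputable def finitePart (D : FFDivisor k F) : HeightOneSpectrum R →₀ ℤ :=
  D.comapDomain (ofPrime k F) (ofPrime_injective k R F).injOn

theorem finitePart_apply (D : FFDivisor k F) (v : HeightOneSpectrum R) :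
    finitePart R D v = D (ofPrime k F v) := rfl

theorem deg_single_add_mapDomain (h : IsEllipticModel k R F inf) (n : ℤ)
    (E : HeightOneSpectrum R →₀ ℤ) :
    FFDivisor.deg k F (Finsupp.single inf n + E.mapDomain (ofPrime k F)) =
      n + E.sum fun v m => m * (Module.finrank k (R ⧸ v.asIdeal) : ℤ) := by
  rw [map_add, deg_single, h.deg_inf, Nat.cast_one, mul_one, deg_eq_sum,
    Finsupp.sum_mapDomain_index (fun _ => zero_mul _) (fun _ => fun _ _ => add_mul _ _ _)]
  simp only [deg_ofPrime]

theorem single_add_mapDomain_inf (h : IsEllipticModel k R F inf) (n : ℤ)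
    (E : HeightOneSpectrum R →₀ ℤ) :
    (Finsupp.single inf n + E.mapDomain (ofPrime k F)) inf = n := by
  rw [Finsupp.add_apply, Finsupp.single_eq_same, Finsupp.mapDomain_of_notMem_range, add_zero]
  rintro ⟨v, hv⟩
  exact h.ofPrime_ne v hv

theorem single_add_mapDomain_ofPrime (h : IsEllipticModel k R F inf) (n : ℤ)
    (E : HeightOneSpectrum R →₀ ℤ) (v : HeightOneSpectrum R) :
    (Finsupp.single inf n + E.mapDomain (ofPrime k F)) (ofPrime k F v) = E v := by
  rw [Finsupp.add_apply, Finsupp.mapDomain_apply (ofPrime_injective k R F),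
    Finsupp.single_eq_of_ne (h.ofPrime_ne v), zero_add]

theorem eq_single_add_mapDomain (h : IsEllipticModel k R F inf) (D : FFDivisor k F) :
    D = Finsupp.single inf (D inf) + (finitePart R D).mapDomain (ofPrime k F) := by
  ext x
  rcases h.eq_inf_or_exists x with rfl | ⟨v, rfl⟩
  · rw [h.single_add_mapDomain_inf]
  · rw [h.single_add_mapDomain_ofPrime, finitePart_apply]

theorem deg_eq (h : IsEllipticModel k R F inf) (D : FFDivisor k F) :
    FFDivisor.deg k F D = D inf +
      (finitePart R D).sum fun v m => m * (Module.finrank k (R ⧸ v.asIdeal) : ℤ) := by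
  conv_lhs => rw [h.eq_single_add_mapDomain D]
  exact h.deg_single_add_mapDomain _ _

variable [Finite k] [Infinite R] [Ring.HasFiniteQuotients R]

/-- The affine part comes from the factorisation of the ideal `(r)`. Its degree is the dimension of
`R / (r)`, which the order at infinity cancels. -/
theorem exists_div_algebraMap (h : IsEllipticModel k R F inf) {r : R} (hr : r ≠ 0) :
    ∃ D : FFDivisor k F, (∀ x, D x = x.ord (algebraMap R F r)) ∧ FFDivisor.deg k F D = 0 := by
  obtain ⟨E, hE, hs⟩ := exists_finsupp_multiplicity k (I := Ideal.span {r})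
    (by simpa [Ideal.span_singleton_eq_bot] using hr)
  refine ⟨Finsupp.single inf (inf.ord (algebraMap R F r)) +
    (E.mapRange (Nat.cast : ℕ → ℤ) Nat.cast_zero).mapDomain (ofPrime k F), fun x => ?_, ?_⟩
  · rcases h.eq_inf_or_exists x with rfl | ⟨v, rfl⟩
    · rw [h.single_add_mapDomain_inf]
    · rw [h.single_add_mapDomain_ofPrime, Finsupp.mapRange_apply, hE, ord_ofPrime_algebraMap v hr]
  · rw [h.deg_single_add_mapDomain, h.ord_inf r hr, hs,
      Finsupp.sum_mapRange_index (fun _ => zero_mul _), Finsupp.sum, Finsupp.sum]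
    push_cast
    ring

theorem exists_div (h : IsEllipticModel k R F inf) {f : F} (hf : f ≠ 0) :
    ∃ D : FFDivisor k F, (∀ x, D x = x.ord f) ∧ FFDivisor.deg k F D = 0 := by
  obtain ⟨r, s, hs, rfl⟩ := IsFractionRing.div_surjective R f
  have hs0 : s ≠ 0 := nonZeroDivisors.ne_zero hs
  have hs1 : algebraMap R F s ≠ 0 := by simpa using hs0
  have hr1 : algebraMap R F r ≠ 0 := by
    intro h0
    simp [h0] at hf
  have hr0 : r ≠ 0 := by simpa using hr1
  obtain ⟨D, hD, hD0⟩ := h.exists_div_algebraMap hr0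
  obtain ⟨E, hE, hE0⟩ := h.exists_div_algebraMap hs0
  refine ⟨D - E, fun x => ?_, by rw [map_sub, hD0, hE0, sub_zero]⟩
  rw [Finsupp.sub_apply, hD, hE, div_eq_mul_inv, ord_mul x hr1 (inv_ne_zero hs1), ord_inv,
    sub_eq_add_neg]

theorem div_apply (h : IsEllipticModel k R F inf) {f : F} (hf : f ≠ 0) (x : FFPlace k F) :
    FFDivisor.div k f x = x.ord f := by
  have h0 : ∃ D : FFDivisor k F, ∀ x, D x = x.ord f :=
    let ⟨D, hD, _⟩ := h.exists_div hf
    ⟨D, hD⟩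
  rw [FFDivisor.div, dif_pos h0]
  exact h0.choose_spec x

theorem deg_div (h : IsEllipticModel k R F inf) {f : F} (hf : f ≠ 0) :
    FFDivisor.deg k F (FFDivisor.div k f) = 0 := by
  obtain ⟨D, hD, hD0⟩ := h.exists_div hf
  convert hD0
  ext x
  rw [h.div_apply hf, hD]

theorem mem_principal_iff (h : IsEllipticModel k R F inf) (D : FFDivisor k F) :
    D ∈ FFDivisor.principal k F ↔ ∃ f : F, f ≠ 0 ∧ D = FFDivisor.div k f := by
  constructor
  · rintro ⟨f, hf, hD⟩
    exact ⟨f, hf, Finsupp.ext fun x => by rw [hD, h.div_apply hf]⟩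
  · rintro ⟨f, hf, rfl⟩
    exact ⟨f, hf, h.div_apply hf⟩

theorem mk_eq_mk_iff (h : IsEllipticModel k R F inf) (D E : FFDivisor k F) :
    (QuotientAddGroup.mk D : FFClassGroup k F) = QuotientAddGroup.mk E ↔
      ∃ f : F, f ≠ 0 ∧ D = E + FFDivisor.div k f := by
  rw [eq_comm, QuotientAddGroup.eq, h.mem_principal_iff]
  refine exists_congr fun f => and_congr_right fun _ => ?_
  rw [neg_add_eq_iff_eq_add]

theorem deg_eq_zero_of_mem_principal (h : IsEllipticModel k R F inf) {D : FFDivisor k F}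
    (hD : D ∈ FFDivisor.principal k F) : FFDivisor.deg k F D = 0 := by
  obtain ⟨f, hf, rfl⟩ := (h.mem_principal_iff D).1 hD
  exact h.deg_div hf

theorem deg_pos (h : IsEllipticModel k R F inf) (x : FFPlace k F) : 0 < x.deg := by
  rcases h.eq_inf_or_exists x with rfl | ⟨v, rfl⟩
  · rw [h.deg_inf]
    exact one_pos
  · rw [deg_ofPrime]
    have : Finite (R ⧸ v.asIdeal) := Ring.HasFiniteQuotients.finiteQuotient v.ne_bot
    have := Ideal.Quotient.nontrivial_iff.2 v.isPrime.ne_top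
    have : Module.Finite k (R ⧸ v.asIdeal) := Module.Finite.of_finite
    exact Module.finrank_pos

theorem finite_deg_eq_one (h : IsEllipticModel k R F inf) : {x : FFPlace k F | x.deg = 1}.Finite := by
  refine (((Ring.HasFiniteQuotients.finite_cardQuot_heightOneSpectrum_le (R := R)
    (Nat.card k)).image (ofPrime k F)).insert inf).subset fun x hx => ?_
  rcases h.eq_inf_or_exists x with rfl | ⟨v, rfl⟩
  · exact Or.inl rfl
  · refine Or.inr ⟨v, ?_, rfl⟩
    rw [Set.mem_ofPred_eq, deg_ofPrime] at hx
    rw [Set.mem_ofPred_eq, cardQuot_eq_pow_finrank k v.ne_bot, hx, pow_one]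

theorem eq_zero_of_deg_eq_zero (h : IsEllipticModel k R F inf) {D : FFDivisor k F} (hD : 0 ≤ D)
    (h0 : FFDivisor.deg k F D = 0) : D = 0 := by
  rcases eq_zero_or_exists_single_add hD with hD | ⟨x, E, hE, rfl⟩
  · exact hD
  · rw [map_add, deg_single] at h0
    have h1 := deg_nonneg hE
    have h2 := h.deg_pos x
    omega

theorem eq_single_of_deg_eq_one (h : IsEllipticModel k R F inf) {D : FFDivisor k F} (hD : 0 ≤ D)
    (h1 : FFDivisor.deg k F D = 1) : ∃ x : FFPlace k F, x.deg = 1 ∧ D = Finsupp.single x 1 := by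
  rcases eq_zero_or_exists_single_add hD with rfl | ⟨x, E, hE, rfl⟩
  · simp at h1
  · rw [map_add, deg_single] at h1
    have h2 := deg_nonneg hE
    have h3 := h.deg_pos x
    refine ⟨x, by omega, ?_⟩
    rw [h.eq_zero_of_deg_eq_zero hE (by omega), add_zero]

/-- The product of the `v ^ E v` turns prescribed affine zeros into membership in an ideal whose
codimension is the degree of `E`. -/
theorem exists_ideal (E : HeightOneSpectrum R →₀ ℕ) : ∃ I : Ideal R, I ≠ ⊥ ∧
    Module.finrank k (R ⧸ I) = (E.sum fun v n => n * Module.finrank k (R ⧸ v.asIdeal)) ∧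
    ∀ r ∈ I, r ≠ 0 → ∀ v, (E v : ℤ) ≤ (ofPrime k F v).ord (algebraMap R F r) := by
  refine ⟨E.prod fun v n => v.asIdeal ^ n,
    Finset.prod_ne_zero_iff.2 fun v _ => pow_ne_zero _ v.ne_bot,
    finrank_quotient_finsuppProd k E, fun r hr hr0 v => ?_⟩
  rw [ord_ofPrime_algebraMap v hr0, Nat.cast_le]
  have hspan : Ideal.span {r} ≠ ⊥ := by simpa [Ideal.span_singleton_eq_bot] using hr0
  apply (FiniteMultiplicity.of_prime_left v.prime hspan).le_multiplicity_of_pow_dvd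
  refine Dvd.dvd.trans ?_ (Ideal.dvd_span_singleton.2 hr)
  by_cases hv : v ∈ E.support
  · exact Finset.dvd_prod_of_mem (fun v => v.asIdeal ^ E v) hv
  · rw [Finsupp.notMem_support_iff.1 hv, pow_zero]
    exact one_dvd _

/-- Every divisor of positive degree is equivalent to an effective divisor. -/
theorem exists_effective (h : IsEllipticModel k R F inf) (D : FFDivisor k F)
    (hD : 1 ≤ FFDivisor.deg k F D) : ∃ f : F, f ≠ 0 ∧ 0 ≤ D + FFDivisor.div k f := by
  -- Subtracting the divisor of `g` makes the affine part nonpositive, so only zeros are prescribed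
  -- away from infinity.
  obtain ⟨g, hg0, hg⟩ : ∃ g : R, g ≠ 0 ∧
      ∀ v, D (ofPrime k F v) ≤ (ofPrime k F v).ord (algebraMap R F g) := by
    obtain ⟨I, hI, -, hI2⟩ := exists_ideal (k := k) (F := F)
      ((finitePart R D).mapRange Int.toNat rfl)
    obtain ⟨g, hgI, hg0⟩ := Submodule.exists_mem_ne_zero_of_ne_bot hI
    refine ⟨g, hg0, fun v => le_trans ?_ (hI2 g hgI hg0 v)⟩
    rw [Finsupp.mapRange_apply, finitePart_apply]
    exact Int.self_le_toNat _
  have hg1 : algebraMap R F g ≠ 0 := by simpa using hg0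
  set D' := D - FFDivisor.div k (algebraMap R F g) with hD'
  have hdeg : FFDivisor.deg k F D' = FFDivisor.deg k F D := by
    rw [hD', map_sub, h.deg_div hg1, sub_zero]
  have hle : ∀ v : HeightOneSpectrum R, D' (ofPrime k F v) ≤ 0 := fun v => by
    rw [hD', Finsupp.sub_apply, h.div_apply hg1]
    exact sub_nonpos.2 (hg v)
  obtain ⟨I, hI, hI1, hI2⟩ := exists_ideal (k := k) (F := F)
    ((finitePart R D').mapRange (fun n => (-n).toNat) rfl)
  have hsum : FFDivisor.deg k F D' = D' inf - (Module.finrank k (R ⧸ I) : ℤ) := by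
    rw [h.deg_eq, hI1, Finsupp.sum_mapRange_index (fun _ => zero_mul _), Finsupp.sum, Finsupp.sum,
      Nat.cast_sum, sub_eq_add_neg, ← Finset.sum_neg_distrib]
    congr 1
    refine Finset.sum_congr rfl fun v _ => ?_
    have := hle v
    rw [← finitePart_apply] at this
    push_cast
    rw [Int.toNat_of_nonneg (by omega)]
    ring
  obtain ⟨n, hn⟩ : ∃ n : ℕ, D' inf = n := Int.eq_ofNat_of_zero_le (by omega)
  -- The ideal has codimension `n - deg D < n`, so some nonzero `r` with a pole of order at most `n`
  -- lies in it. The required function is `r / g`.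
  have hn1 : Module.finrank k (R ⧸ I) < Module.finrank k (inf.poleSpace R n) := by
    rw [h.finrank_poleSpace n (by omega)]
    omega
  have : Finite (R ⧸ I) := Ring.HasFiniteQuotients.finiteQuotient hI
  have : Module.Finite k (R ⧸ I) := Module.Finite.of_finite
  have := h.finite_poleSpace (n := n) (by omega)
  have hker := LinearMap.ker_ne_bot_of_finrank_lt
    (f := (Ideal.Quotient.mkₐ k I).toLinearMap.domRestrict (inf.poleSpace R n)) hn1
  obtain ⟨⟨r, hrn⟩, hr1, hr2⟩ := Submodule.exists_mem_ne_zero_of_ne_bot hker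
  have hr0 : r ≠ 0 := fun h0 => hr2 (Subtype.ext h0)
  have hrI : r ∈ I := Ideal.Quotient.eq_zero_iff_mem.1 hr1
  have hrF : algebraMap R F r ≠ 0 := by simpa using hr0
  have hf0 : algebraMap R F r * (algebraMap R F g)⁻¹ ≠ 0 := mul_ne_zero hrF (inv_ne_zero hg1)
  refine ⟨_, hf0, fun x => ?_⟩
  have hx : (D + FFDivisor.div k (algebraMap R F r * (algebraMap R F g)⁻¹)) x =
      D' x + x.ord (algebraMap R F r) := by
    rw [hD', Finsupp.add_apply, Finsupp.sub_apply, h.div_apply hf0, h.div_apply hg1,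
      x.ord_mul hrF (inv_ne_zero hg1), ord_inv]
    ring
  rw [hx, Finsupp.zero_apply]
  rcases h.eq_inf_or_exists x with rfl | ⟨v, rfl⟩
  · have := (mem_poleSpace _ _ hr0).1 hrn
    omega
  · have h1 := hI2 r hrI hr0 v
    rw [Finsupp.mapRange_apply, finitePart_apply] at h1
    have h2 := Int.self_le_toNat (-D' (ofPrime k F v))
    omega

end IsEllipticModel

end

/-! ### Counting the effective divisors in a class -/

section

open WithZero IsDedekindDomain

set_option linter.unusedSectionVars false

namespace IsEllipticModel

open FFPlace FFDivisor

variable {k R F : Type*} [Field k] [CommRing R] [IsDedekindDomain R] [Field F] [Algebra k R]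
  [Algebra k F] [Algebra R F] [IsScalarTower k R F] [IsFractionRing R F] {inf : FFPlace k F}
  [Finite k] [Infinite R] [Ring.HasFiniteQuotients R]

/-- The degree of a divisor class. -/
noncomputable def classDeg (h : IsEllipticModel k R F inf) : FFClassGroup k F →+ ℤ :=
  QuotientAddGroup.lift _ (FFDivisor.deg k F) fun _ hD => h.deg_eq_zero_of_mem_principal hD

theorem classDeg_mk (h : IsEllipticModel k R F inf) (D : FFDivisor k F) :
    h.classDeg (QuotientAddGroup.mk D) = FFDivisor.deg k F D := rfl

theorem mem_degZero_iff (h : IsEllipticModel k R F inf) (c : FFClassGroup k F) :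
    c ∈ FFClassGroup.degZero k F ↔ h.classDeg c = 0 := by
  constructor
  · rintro ⟨D, hD, rfl⟩
    exact hD
  · obtain ⟨D, rfl⟩ := QuotientAddGroup.mk_surjective c
    exact fun hD => ⟨D, hD, rfl⟩

variable (inf) in
/-- The class of a place, as a divisor of multiplicity one. -/
noncomputable def placeClass : FFClassGroup k F := QuotientAddGroup.mk (Finsupp.single inf 1)

theorem classDeg_placeClass (h : IsEllipticModel k R F inf) (x : FFPlace k F) :
    h.classDeg (placeClass x) = x.deg := by
  rw [placeClass, classDeg_mk, deg_single, one_mul]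

theorem classDeg_inf (h : IsEllipticModel k R F inf) : h.classDeg (placeClass inf) = 1 := by
  rw [classDeg_placeClass, h.deg_inf, Nat.cast_one]

/-- Every divisor class of degree one is the class of a place of degree one. -/
theorem exists_placeClass_eq (h : IsEllipticModel k R F inf) {c : FFClassGroup k F}
    (hc : h.classDeg c = 1) : ∃ x : FFPlace k F, x.deg = 1 ∧ placeClass x = c := by
  obtain ⟨D, rfl⟩ := QuotientAddGroup.mk_surjective c
  rw [classDeg_mk] at hc
  obtain ⟨f, hf, hD⟩ := h.exists_effective D hc.ge
  obtain ⟨x, hx, hDx⟩ := h.eq_single_of_deg_eq_one hD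
    (by rw [map_add, h.deg_div hf, hc, add_zero])
  exact ⟨x, hx, by rw [placeClass, ← hDx, h.mk_eq_mk_iff]; exact ⟨f, hf, rfl⟩⟩

/-- The map `x ↦ [x] - [∞]` from the finitely many rational places is onto, because every class of
degree one contains such a place. -/
theorem finite_degZero (h : IsEllipticModel k R F inf) : Finite (FFClassGroup.degZero k F) := by
  have : Finite {x : FFPlace k F | x.deg = 1} := h.finite_deg_eq_one.to_subtype
  have hmem : ∀ x : {x : FFPlace k F | x.deg = 1},
      placeClass x.1 - placeClass inf ∈ FFClassGroup.degZero k F := fun x => by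
    rw [h.mem_degZero_iff, map_sub, h.classDeg_inf, h.classDeg_placeClass,
      show x.1.deg = 1 from x.2, Nat.cast_one, sub_self]
  refine Finite.of_surjective (fun x => (⟨_, hmem x⟩ : FFClassGroup.degZero k F)) fun c => ?_
  obtain ⟨x, hx, hxc⟩ := h.exists_placeClass_eq (c := c.1 + placeClass inf)
    (by rw [map_add, (h.mem_degZero_iff c.1).1 c.2, h.classDeg_inf, zero_add])
  exact ⟨⟨x, hx⟩, Subtype.ext (by
    show placeClass x - placeClass inf = c.1
    rw [hxc, add_sub_cancel_right])⟩

theorem exists_algebraMap_eq {f : F}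
    (hf : ∀ v : HeightOneSpectrum R, 0 ≤ (ofPrime k F v).ord f) (hf0 : f ≠ 0) :
    ∃ r : R, algebraMap R F r = f := by
  apply HeightOneSpectrum.mem_integers_of_valuation_le_one
  intro v
  rw [← valuation_ofPrime (k := k), valuation_le_one_iff, ← ord_nonneg_iff _ hf0]
  exact hf v

/-- A function without zeros and poles is constant. -/
theorem exists_const (h : IsEllipticModel k R F inf) {f : F} (hf0 : f ≠ 0)
    (hf : ∀ x : FFPlace k F, x.ord f = 0) : ∃ c : kˣ, algebraMap k F c = f := by
  obtain ⟨r, rfl⟩ := exists_algebraMap_eq (k := k) (R := R) (fun v => (hf _).ge) hf0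
  have hr0 : r ≠ 0 := by simpa using hf0
  -- The space of pole order at most `1` is one-dimensional and contains `1`, hence consists of
  -- constants.
  have h1 : (1 : R) ∈ inf.poleSpace R ((1 : ℕ) : ℤ) := by
    rw [mem_poleSpace _ _ one_ne_zero, map_one, ord_one]
    omega
  have hr : r ∈ inf.poleSpace R ((1 : ℕ) : ℤ) := by
    rw [mem_poleSpace _ _ hr0, hf]
    omega
  obtain ⟨c, hc⟩ := (finrank_eq_one_iff_of_nonzero' (⟨1, h1⟩ : inf.poleSpace R ((1 : ℕ) : ℤ))
    (fun h0 => one_ne_zero (congrArg Subtype.val h0))).1 (h.finrank_poleSpace 1 le_rfl) ⟨r, hr⟩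
  have hc' : c • (1 : R) = r := congrArg Subtype.val hc
  have hc0 : c ≠ 0 := by
    rintro rfl
    rw [zero_smul] at hc'
    exact hr0 hc'.symm
  exact ⟨Units.mk0 c hc0, by
    rw [Units.val_mk0, ← hc', Algebra.smul_def, mul_one, ← IsScalarTower.algebraMap_apply]⟩

/-- The effective divisors in a class correspond to the nonzero sections up to constants. -/
theorem card_effective (h : IsEllipticModel k R F inf) (D : FFDivisor k F)
    (hD : ∀ v : HeightOneSpectrum R, D (ofPrime k F v) ≤ 0) (U : Submodule k R) [Finite U]
    (hU : ∀ r : R, r ≠ 0 → (r ∈ U ↔ 0 ≤ D + FFDivisor.div k (algebraMap R F r))) :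
    Finite {E : FFDivisor k F // 0 ≤ E ∧ (QuotientAddGroup.mk E : FFClassGroup k F) =
      QuotientAddGroup.mk D} ∧
    Nat.card {E : FFDivisor k F // 0 ≤ E ∧ (QuotientAddGroup.mk E : FFClassGroup k F) =
      QuotientAddGroup.mk D} * (Nat.card k - 1) + 1 = Nat.card U := by
  set S := {E : FFDivisor k F // 0 ≤ E ∧ (QuotientAddGroup.mk E : FFClassGroup k F) =
      QuotientAddGroup.mk D}
  -- As `D` is nonpositive away from infinity, a section has no affine poles and therefore lies in
  -- `R`.
  have hex : ∀ E : S, ∃ r : R, r ≠ 0 ∧ E.1 = D + FFDivisor.div k (algebraMap R F r) := by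
    rintro ⟨E, hE, hEc⟩
    obtain ⟨f, hf, hEf⟩ := (h.mk_eq_mk_iff E D).1 hEc
    obtain ⟨r, rfl⟩ := exists_algebraMap_eq (k := k) (R := R) (f := f) (fun v => by
      have h1 := hE (ofPrime k F v)
      rw [hEf, Finsupp.add_apply, h.div_apply hf, Finsupp.zero_apply] at h1
      have h2 := hD v
      omega) hf
    exact ⟨r, by simpa using hf, hEf⟩
  choose ρ hρ0 hρ using hex
  have hρF : ∀ E, algebraMap R F (ρ E) ≠ 0 := fun E => by simpa using hρ0 E
  have hsmul : ∀ (c : kˣ) (r : R), algebraMap R F ((c : k) • r) =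
      algebraMap k F c * algebraMap R F r := fun c r => by
    rw [Algebra.smul_def, map_mul, ← IsScalarTower.algebraMap_apply]
  have hc0 : ∀ c : kˣ, algebraMap k F c ≠ 0 := fun c => by simp
  have hdiv : ∀ (c : kˣ) (r : R), r ≠ 0 → FFDivisor.div k (algebraMap R F ((c : k) • r)) =
      FFDivisor.div k (algebraMap R F r) := fun c r hr => by
    have hr' : algebraMap R F r ≠ 0 := by simpa using hr
    ext x
    rw [hsmul, h.div_apply (mul_ne_zero (hc0 c) hr'), h.div_apply hr', x.ord_mul (hc0 c) hr',
      x.ord_algebraMap c.ne_zero, zero_add]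
  have hne : ∀ (c : kˣ) (E : S), (c : k) • ρ E ≠ 0 := fun c E =>
    smul_ne_zero c.ne_zero (hρ0 E)
  have hmem : ∀ (c : kˣ) (E : S), (c : k) • ρ E ∈ U := fun c E => by
    rw [hU _ (hne c E), hdiv _ _ (hρ0 E), ← hρ]
    exact E.2.1
  -- Scaling a chosen section of each divisor reaches each nonzero section exactly once, since two
  -- functions with the same divisor differ by a constant.
  let φ : S × kˣ → {u : U // u ≠ 0} := fun p =>
    ⟨⟨(p.2 : k) • ρ p.1, hmem _ _⟩, fun h0 => hne p.2 p.1 (congrArg Subtype.val h0)⟩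
  have hφ : Function.Bijective φ := by
    constructor
    · rintro ⟨E, c⟩ ⟨E', c'⟩ hEc
      have h1 : (c : k) • ρ E = (c' : k) • ρ E' :=
        congrArg (fun u : {u : U // u ≠ 0} => (u : R)) hEc
      have hEE : E = E' := by
        apply Subtype.ext
        rw [hρ E, hρ E', ← hdiv c _ (hρ0 E), h1, hdiv c' _ (hρ0 E')]
      subst hEE
      rw [Prod.mk.injEq]
      refine ⟨rfl, Units.ext ?_⟩
      have h2 := congrArg (algebraMap R F) h1
      rw [hsmul, hsmul] at h2
      exact (algebraMap k F).injective (mul_right_cancel₀ (hρF E) h2)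
    · rintro ⟨⟨r, hr⟩, hr0⟩
      have hr0 : r ≠ 0 := fun h0 => hr0 (Subtype.ext h0)
      have hrF : algebraMap R F r ≠ 0 := by simpa using hr0
      let E : S := ⟨D + FFDivisor.div k (algebraMap R F r), (hU r hr0).1 hr,
        (h.mk_eq_mk_iff _ _).2 ⟨_, hrF, rfl⟩⟩
      have hE : FFDivisor.div k (algebraMap R F r) = FFDivisor.div k (algebraMap R F (ρ E)) :=
        add_left_cancel (hρ E)
      obtain ⟨c, hc⟩ := h.exists_const (f := algebraMap R F r * (algebraMap R F (ρ E))⁻¹)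
        (mul_ne_zero hrF (inv_ne_zero (hρF E))) fun x => by
          rw [x.ord_mul hrF (inv_ne_zero (hρF E)), ord_inv, ← h.div_apply hrF, hE,
            h.div_apply (hρF E), add_neg_cancel]
      refine ⟨(E, c), Subtype.ext (Subtype.ext ?_)⟩
      apply IsFractionRing.injective R F
      show algebraMap R F ((c : k) • ρ E) = algebraMap R F r
      rw [hsmul, hc, inv_mul_cancel_right₀ (hρF E)]
  have hfin : Finite (S × kˣ) := Finite.of_injective φ hφ.1
  refine ⟨Finite.of_injective (fun E : S => (E, (1 : kˣ))) fun E E' h0 => (Prod.mk.inj h0).1, ?_⟩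
  have hcard := Nat.card_congr (Equiv.ofBijective φ hφ)
  rw [Nat.card_prod, Nat.card_units] at hcard
  rw [hcard]
  have : Fintype U := Fintype.ofFinite U
  classical
  rw [Nat.card_eq_fintype_card, Fintype.card_subtype_compl, Nat.card_eq_fintype_card,
    Fintype.card_subtype_eq, Nat.sub_add_cancel Fintype.card_pos]

/-- Evaluation at the rational point `v` maps onto a one-dimensional space, because `1` does not
vanish there; the kernel loses one dimension. -/
theorem finrank_poleSpace_inf_asIdeal (h : IsEllipticModel k R F inf) {n : ℕ}
    (v : HeightOneSpectrum R) (hv : Module.finrank k (R ⧸ v.asIdeal) = 1) :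
    Module.finrank k
      (inf.poleSpace R (n + 1 : ℕ) ⊓ v.asIdeal.restrictScalars k : Submodule k R) = n := by
  set V := inf.poleSpace R (n + 1 : ℕ)
  have : Module.Finite k V := h.finite_poleSpace (by omega)
  have hfin : Module.Finite k (R ⧸ v.asIdeal) := Module.finite_of_finrank_pos (by omega)
  let φ : V →ₗ[k] R ⧸ v.asIdeal := (Ideal.Quotient.mkₐ k v.asIdeal).toLinearMap.domRestrict V
  have h1 : (1 : R) ∈ V := by
    rw [mem_poleSpace _ _ one_ne_zero, map_one, ord_one]
    omega
  have hsurj : LinearMap.range φ = ⊤ := by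
    have hne : LinearMap.range φ ≠ ⊥ := by
      rw [Submodule.ne_bot_iff]
      refine ⟨φ ⟨1, h1⟩, ⟨_, rfl⟩, fun h0 => ?_⟩
      exact v.isPrime.ne_top ((Ideal.eq_top_iff_one _).2 (Ideal.Quotient.eq_zero_iff_mem.1 h0))
    apply Submodule.eq_top_of_finrank_eq
    have h2 := Submodule.one_le_finrank_iff.2 hne
    have h3 := Submodule.finrank_le (LinearMap.range φ)
    omega
  have hrank := LinearMap.finrank_range_add_finrank_ker φ
  rw [hsurj, finrank_top, hv, h.finrank_poleSpace _ (by omega)] at hrank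
  have hker : V ⊓ v.asIdeal.restrictScalars k = (LinearMap.ker φ).map V.subtype := by
    ext r
    simp only [Submodule.mem_inf, Submodule.mem_map, LinearMap.mem_ker, Submodule.restrictScalars_mem,
      Submodule.subtype_apply, Subtype.exists, exists_and_right, exists_eq_right]
    constructor
    · rintro ⟨hr, hv⟩
      exact ⟨hr, Ideal.Quotient.eq_zero_iff_mem.2 hv⟩
    · rintro ⟨hr, hv⟩
      exact ⟨hr, Ideal.Quotient.eq_zero_iff_mem.1 hv⟩
  rw [hker, ← (Submodule.equivSubtypeMap V (LinearMap.ker φ)).finrank_eq]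
  omega

/-- The number of effective divisors in a class of positive degree. -/
theorem card_effective_of_pos (h : IsEllipticModel k R F inf) {c : FFClassGroup k F} {n : ℕ}
    (hn : 1 ≤ n) (hc : h.classDeg c = n) :
    Finite {E : FFDivisor k F // 0 ≤ E ∧ (QuotientAddGroup.mk E : FFClassGroup k F) = c} ∧
    Nat.card {E : FFDivisor k F // 0 ≤ E ∧ (QuotientAddGroup.mk E : FFClassGroup k F) = c} *
      (Nat.card k - 1) + 1 = Nat.card k ^ n := by
  -- The class `(n + 1)[∞] - c` has degree one, so it is the class of a rational point `x`, and `c`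
  -- is represented by `(n + 1)∞ - x`.
  obtain ⟨x, hx, hxc⟩ := h.exists_placeClass_eq (c := (n + 1) • placeClass inf - c) (by
    rw [map_sub, map_nsmul, h.classDeg_inf, hc]
    simp)
  have hcD : c = QuotientAddGroup.mk (Finsupp.single inf ((n + 1 : ℕ) : ℤ) - Finsupp.single x 1) := by
    rw [QuotientAddGroup.mk_sub, ← sub_eq_iff_eq_add.2 (sub_eq_iff_eq_add'.1 hxc.symm)]
    congr 1
    rw [placeClass, ← QuotientAddGroup.mk_nsmul]
    simp
  rw [hcD]
  -- For `x = ∞` the sections are the pole space of order `n`; otherwise they are those of order `n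
  -- + 1` that vanish at `x`. Either space has dimension `n`.
  rcases h.eq_inf_or_exists x with rfl | ⟨v, rfl⟩
  · have := h.finite_poleSpace hn
    have : Finite (x.poleSpace R (n : ℤ)) := Module.finite_of_finite k
    have hD : Finsupp.single x ((n + 1 : ℕ) : ℤ) - Finsupp.single x 1 =
        (Finsupp.single x (n : ℤ) : FFDivisor k F) := by
      rw [← Finsupp.single_sub]
      push_cast
      rw [add_sub_cancel_right]
    rw [hD]
    have := h.card_effective (Finsupp.single x (n : ℤ)) (fun v => by
      rw [Finsupp.single_eq_of_ne (h.ofPrime_ne v)]) (x.poleSpace R (n : ℤ)) (fun r hr => by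
      have hrF : algebraMap R F r ≠ 0 := by simpa using hr
      rw [mem_poleSpace _ _ hr]
      constructor
      · intro hr1 y
        rw [Finsupp.zero_apply, Finsupp.add_apply, h.div_apply hrF]
        rcases h.eq_inf_or_exists y with rfl | ⟨v, rfl⟩
        · rw [Finsupp.single_eq_same]
          omega
        · rw [Finsupp.single_eq_of_ne (h.ofPrime_ne v), zero_add, ord_nonneg_iff _ hrF]
          exact algebraMap_mem_ofPrime v r
      · intro h0
        have := h0 x
        rw [Finsupp.zero_apply, Finsupp.add_apply, h.div_apply hrF, Finsupp.single_eq_same] at this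
        omega)
    rwa [Module.natCard_eq_pow_finrank (K := k) (V := x.poleSpace R (n : ℤ)),
      h.finrank_poleSpace n hn] at this
  · rw [deg_ofPrime] at hx
    have hrank := h.finrank_poleSpace_inf_asIdeal (n := n) v hx
    set U := (inf.poleSpace R (n + 1 : ℕ) ⊓ v.asIdeal.restrictScalars k : Submodule k R)
    have : Module.Finite k U := Module.finite_of_finrank_pos (by omega)
    have : Finite U := Module.finite_of_finite k
    have := h.card_effective
      (Finsupp.single inf ((n + 1 : ℕ) : ℤ) - Finsupp.single (ofPrime k F v) 1) (fun w => by
        rw [Finsupp.sub_apply, Finsupp.single_eq_of_ne (h.ofPrime_ne w), zero_sub]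
        by_cases hvw : ofPrime k F w = ofPrime k F v
        · rw [hvw, Finsupp.single_eq_same]
          omega
        · rw [Finsupp.single_eq_of_ne hvw]
          omega) U (fun r hr => by
      have hrF : algebraMap R F r ≠ 0 := by simpa using hr
      have hrv : r ∈ v.asIdeal ↔ 0 < (ofPrime k F v).ord (algebraMap R F r) := by
        rw [ord_pos_iff _ hrF, valuation_ofPrime, v.valuation_lt_one_iff_mem]
      rw [Submodule.mem_inf, mem_poleSpace _ _ hr, Submodule.restrictScalars_mem, hrv]
      constructor
      · rintro ⟨hr1, hr2⟩ y
        rw [Finsupp.zero_apply, Finsupp.add_apply, h.div_apply hrF, Finsupp.sub_apply]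
        rcases h.eq_inf_or_exists y with rfl | ⟨w, rfl⟩
        · rw [Finsupp.single_eq_same, Finsupp.single_eq_of_ne' (h.ofPrime_ne v)]
          omega
        · rw [Finsupp.single_eq_of_ne (h.ofPrime_ne w), zero_sub]
          by_cases hvw : ofPrime k F w = ofPrime k F v
          · rw [hvw, Finsupp.single_eq_same]
            omega
          · rw [Finsupp.single_eq_of_ne hvw, neg_zero, zero_add, ord_nonneg_iff _ hrF]
            exact algebraMap_mem_ofPrime w r
      · intro h0
        have h1 := h0 inf
        have h2 := h0 (ofPrime k F v)
        rw [Finsupp.zero_apply, Finsupp.add_apply, h.div_apply hrF, Finsupp.sub_apply,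
          Finsupp.single_eq_same, Finsupp.single_eq_of_ne' (h.ofPrime_ne v)] at h1
        rw [Finsupp.zero_apply, Finsupp.add_apply, h.div_apply hrF, Finsupp.sub_apply,
          Finsupp.single_eq_same, Finsupp.single_eq_of_ne (h.ofPrime_ne v)] at h2
        omega)
    rwa [Module.natCard_eq_pow_finrank (K := k) (V := U), hrank] at this

theorem eq_zero_iff_of_classDeg_eq_zero (h : IsEllipticModel k R F inf) {c : FFClassGroup k F}
    (hc : h.classDeg c = 0) (E : FFDivisor k F) :
    (0 ≤ E ∧ (QuotientAddGroup.mk E : FFClassGroup k F) = c) ↔ E = 0 ∧ c = 0 := by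
  constructor
  · rintro ⟨hE, rfl⟩
    have := h.eq_zero_of_deg_eq_zero hE hc
    subst this
    exact ⟨rfl, rfl⟩
  · rintro ⟨rfl, rfl⟩
    exact ⟨le_rfl, rfl⟩

end IsEllipticModel

end

/-! ### Weierstrass curves give elliptic models -/

section

open WithZero IsDedekindDomain Polynomial

namespace WeierstrassCurve.Affine

open CoordinateRing

variable {k : Type*} [Field k] (W : Affine k)

instance : Infinite W.CoordinateRing :=
  Infinite.of_injective (algebraMap k[X] W.CoordinateRing)
    (FaithfulSMul.algebraMap_injective k[X] W.CoordinateRing)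

instance [Finite k] : Ring.HasFiniteQuotients W.CoordinateRing :=
  have := Ring.HasFiniteQuotients.polynomial k
  Ring.HasFiniteQuotients.of_module_finite k[X] W.CoordinateRing

theorem isEllipticModel (F : Type*) [Field F] [Algebra k F] [Algebra W.CoordinateRing F]
    [IsScalarTower k W.CoordinateRing F] [IsFractionRing W.CoordinateRing F] :
    IsEllipticModel k W.CoordinateRing F (infPlace W F) where
  deg_inf := deg_infPlace W F
  eq_inf := eq_infPlace W F
  ord_inf r hr := ord_infPlace_algebraMap W F hr
  finrank_poleSpace n hn := by
    have : (infPlace W F).poleSpace W.CoordinateRing n = degreeLT W (n + 1) := by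
      ext r
      rcases eq_or_ne r 0 with rfl | hr
      · simp
      · rw [FFPlace.mem_poleSpace _ _ hr, ← neg_lt_ord_infPlace_iff W F hr]
        push_cast
        omega
    rw [this, finrank_degreeLT hn]

end WeierstrassCurve.Affine

end

/-! ### The `L`-series as a rational function of `u` -/

section

open IsDedekindDomain Filter Topology

set_option linter.unusedSectionVars false

theorem hasSum_prod_of_fintype {ι β α : Type*} [Fintype ι] [AddCommMonoid α] [TopologicalSpace α]
    [ContinuousAdd α] {f : ι × β → α} {g : ι → α} (hf : ∀ i, HasSum (fun b => f (i, b)) (g i)) :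
    HasSum f (∑ i, g i) := by
  classical
  have h1 : ∀ i, HasSum (fun p : ι × β => if p.1 = i then f p else 0) (g i) := fun i => by
    rw [← (Prod.mk_right_injective i).hasSum_iff]
    · simpa [Function.comp_def] using hf i
    · rintro ⟨j, b⟩ hj
      rw [if_neg]
      rintro rfl
      exact hj ⟨b, rfl⟩
  convert hasSum_sum (s := Finset.univ) fun i _ => h1 i using 2 with p
  simp

/-- For `n ≥ 1` the coefficient is `(q ^ n - 1) / (q - 1)`, so the series is a difference of two
geometric series. That formula gives `0` at `n = 0`, where `ε` is added. -/
theorem hasSum_genus_one {𝕜 : Type*} [RCLike 𝕜] {q : ℕ} (hq : 2 ≤ q) {u : 𝕜} (hu : ‖(q : 𝕜) * u‖ < 1)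
    (ε : 𝕜) (A : ℕ → ℕ) (hA0 : (A 0 : 𝕜) = ε)
    (hA : ∀ n, 1 ≤ n → A n * (q - 1) + 1 = q ^ n) :
    HasSum (fun n => (A n : 𝕜) * u ^ n) (ε + u / ((1 - u) * (1 - q * u))) := by
  have hq1 : ((q : 𝕜) - 1) ≠ 0 := by
    rw [sub_ne_zero]
    exact_mod_cast (by omega : q ≠ 1)
  have hqn : (1 : ℝ) ≤ ‖(q : 𝕜)‖ := by
    rw [RCLike.norm_natCast]
    exact_mod_cast (by omega : 1 ≤ q)
  have hu1 : ‖u‖ < 1 := by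
    refine lt_of_le_of_lt ?_ hu
    rw [norm_mul]
    exact le_mul_of_one_le_left (norm_nonneg u) hqn
  have h1u : (1 - u) ≠ 0 := by
    intro h0
    rw [← sub_eq_zero.1 h0, norm_one] at hu1
    exact lt_irrefl _ hu1
  have h1qu : (1 - (q : 𝕜) * u) ≠ 0 := by
    intro h0
    rw [← sub_eq_zero.1 h0, norm_one] at hu
    exact lt_irrefl _ hu
  have hs := ((hasSum_geometric_of_norm_lt_one hu).sub (hasSum_geometric_of_norm_lt_one hu1)).mul_left
    ((q : 𝕜) - 1)⁻¹
  have h2 := (hasSum_ite_eq (0 : ℕ) ε).add hs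
  convert h2 using 1
  · funext n
    rcases Nat.eq_zero_or_pos n with rfl | hn
    · simp [hA0]
    · have h3 := congrArg (Nat.cast : ℕ → 𝕜) (hA n hn)
      push_cast [Nat.cast_sub (by omega : 1 ≤ q)] at h3
      rw [if_neg (by omega), zero_add, mul_pow, eq_sub_of_add_eq h3 |> fun h => (eq_div_of_mul_eq hq1 h)]
      field_simp
  · have h1uq : 1 - u * (q : 𝕜) ≠ 0 := by rwa [mul_comm]
    rw [inv_sub_inv h1qu h1u]
    field_simp
    ring

namespace IsEllipticModel

open FFPlace FFDivisor

variable {k R F : Type*} [Field k] [CommRing R] [IsDedekindDomain R] [Field F] [Algebra k R]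
  [Algebra k F] [Algebra R F] [IsScalarTower k R F] [IsFractionRing R F] {inf : FFPlace k F}
  [Finite k] [Infinite R] [Ring.HasFiniteQuotients R]

/-- The projection of the class group to the classes of degree zero along the place at infinity. -/
noncomputable def toDegZero (h : IsEllipticModel k R F inf) :
    FFClassGroup k F →+ FFClassGroup.degZero k F where
  toFun c := ⟨c - h.classDeg c • placeClass inf, by
    rw [h.mem_degZero_iff, map_sub, map_zsmul, h.classDeg_inf]
    simp⟩
  map_zero' := Subtype.ext (by simp)
  map_add' c d := Subtype.ext (by
    simp only [map_add, add_zsmul, AddSubgroup.coe_add]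
    abel)

theorem coe_toDegZero (h : IsEllipticModel k R F inf) (c : FFClassGroup k F) :
    (h.toDegZero c : FFClassGroup k F) = c - h.classDeg c • placeClass inf := rfl

theorem toDegZero_coe (h : IsEllipticModel k R F inf) (c : FFClassGroup.degZero k F) :
    h.toDegZero c = c := by
  apply Subtype.ext
  rw [coe_toDegZero, (h.mem_degZero_iff _).1 c.2, zero_zsmul, sub_zero]

/-- The degree zero part of the class, and the degree, of an effective divisor. -/
noncomputable def classIndex (h : IsEllipticModel k R F inf) (D : {D : FFDivisor k F // 0 ≤ D}) :
    FFClassGroup.degZero k F × ℕ :=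
  (h.toDegZero (QuotientAddGroup.mk D.1), (FFDivisor.deg k F D.1).toNat)

theorem classIndex_eq_iff (h : IsEllipticModel k R F inf) (D : {D : FFDivisor k F // 0 ≤ D})
    (y : FFClassGroup.degZero k F × ℕ) : h.classIndex D = y ↔
      (QuotientAddGroup.mk D.1 : FFClassGroup k F) = y.1 + y.2 • placeClass inf := by
  have hD := FFDivisor.deg_nonneg D.2
  obtain ⟨c, n⟩ := y
  rw [classIndex, Prod.mk.injEq, Subtype.ext_iff, coe_toDegZero, classDeg_mk]
  constructor
  · rintro ⟨hc, hn⟩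
    rw [← hc, ← hn, ← natCast_zsmul, Int.toNat_of_nonneg hD, sub_add_cancel]
  · intro hc
    have h1 := congrArg h.classDeg hc
    rw [classDeg_mk, map_add, (h.mem_degZero_iff _).1 c.2, map_nsmul, h.classDeg_inf] at h1
    simp only [nsmul_eq_mul, mul_one, zero_add] at h1
    rw [h1, hc]
    simp

/-- The divisors with given class index are the effective divisors in a class. -/
def classIndexEquiv (h : IsEllipticModel k R F inf) (y : FFClassGroup.degZero k F × ℕ) :
    {D : {D : FFDivisor k F // 0 ≤ D} // h.classIndex D = y} ≃
      {E : FFDivisor k F // 0 ≤ E ∧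
        (QuotientAddGroup.mk E : FFClassGroup k F) = y.1 + y.2 • placeClass inf} where
  toFun D := ⟨D.1.1, D.1.2, (h.classIndex_eq_iff _ _).1 D.2⟩
  invFun E := ⟨⟨E.1, E.2.1⟩, (h.classIndex_eq_iff _ _).2 E.2.2⟩
  left_inv _ := rfl
  right_inv _ := rfl

theorem classDeg_add_nsmul (h : IsEllipticModel k R F inf) (y : FFClassGroup.degZero k F × ℕ) :
    h.classDeg (y.1 + y.2 • placeClass inf) = y.2 := by
  rw [map_add, (h.mem_degZero_iff _).1 y.1.2, map_nsmul, h.classDeg_inf]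
  simp

theorem finite_fiber (h : IsEllipticModel k R F inf) (y : FFClassGroup.degZero k F × ℕ) :
    Finite {D : {D : FFDivisor k F // 0 ≤ D} // h.classIndex D = y} := by
  rcases Nat.eq_zero_or_pos y.2 with hy | hy
  · have hd : h.classDeg (y.1 + y.2 • placeClass inf) = 0 := by
      rw [h.classDeg_add_nsmul, hy, Nat.cast_zero]
    refine Finite.of_injective (fun _ => ()) fun D E _ => ?_
    apply (h.classIndexEquiv y).injective
    apply Subtype.ext
    have h1 := (h.classIndexEquiv y D).2
    have h2 := (h.classIndexEquiv y E).2
    rw [h.eq_zero_iff_of_classDeg_eq_zero hd] at h1 h2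
    rw [h1.1, h2.1]
  · have := (h.card_effective_of_pos hy (h.classDeg_add_nsmul y)).1
    exact Finite.of_equiv _ (h.classIndexEquiv y).symm

theorem card_fiber_zero (h : IsEllipticModel k R F inf) (c : FFClassGroup.degZero k F) :
    Nat.card {D : {D : FFDivisor k F // 0 ≤ D} // h.classIndex D = (c, 0)} =
      open Classical in if c = 0 then 1 else 0 := by
  have hd : h.classDeg (c + 0 • placeClass inf : FFClassGroup k F) = 0 :=
    h.classDeg_add_nsmul (c, 0)
  have he : ∀ E : FFDivisor k F, (0 ≤ E ∧ (QuotientAddGroup.mk E : FFClassGroup k F) =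
      c + 0 • placeClass inf) ↔ E = 0 ∧ c = 0 := fun E => by
    rw [h.eq_zero_iff_of_classDeg_eq_zero hd, zero_nsmul, add_zero, ZeroMemClass.coe_eq_zero]
  rw [Nat.card_congr ((h.classIndexEquiv (c, 0)).trans (Equiv.subtypeEquivRight he))]
  split_ifs with hc
  · simp [hc]
  · simp [hc]

theorem card_fiber_of_pos (h : IsEllipticModel k R F inf) (c : FFClassGroup.degZero k F) {n : ℕ}
    (hn : 1 ≤ n) :
    Nat.card {D : {D : FFDivisor k F // 0 ≤ D} // h.classIndex D = (c, n)} * (Nat.card k - 1) + 1 =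
      Nat.card k ^ n := by
  rw [Nat.card_congr (h.classIndexEquiv (c, n))]
  exact (h.card_effective_of_pos hn (h.classDeg_add_nsmul (c, n))).2

/-- The field is left general so that the same sum serves over `ℂ` for the value and over `ℝ` for
absolute convergence. -/
theorem hasSum_card_fiber (h : IsEllipticModel k R F inf) [Fintype (FFClassGroup.degZero k F)]
    {𝕜 : Type*} [RCLike 𝕜] (a : FFClassGroup.degZero k F → 𝕜) {u : 𝕜}
    (hu : ‖(Nat.card k : 𝕜) * u‖ < 1) :
    HasSum (fun y : FFClassGroup.degZero k F × ℕ =>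
      (Nat.card {D : {D : FFDivisor k F // 0 ≤ D} // h.classIndex D = y} : 𝕜) * (a y.1 * u ^ y.2))
      (a 0 + (∑ c, a c) * (u / ((1 - u) * (1 - Nat.card k * u)))) := by
  classical
  have h1 := hasSum_prod_of_fintype (f := fun y : FFClassGroup.degZero k F × ℕ =>
      (Nat.card {D : {D : FFDivisor k F // 0 ≤ D} // h.classIndex D = y} : 𝕜) * (a y.1 * u ^ y.2))
    (g := fun c => a c * ((if c = 0 then 1 else 0) + u / ((1 - u) * (1 - Nat.card k * u))))
    fun c => by
      have h2 := (hasSum_genus_one (𝕜 := 𝕜) (Finite.one_lt_card (α := k)) hu (if c = 0 then 1 else 0)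
        (fun n => Nat.card {D : {D : FFDivisor k F // 0 ≤ D} // h.classIndex D = (c, n)})
        (by rw [h.card_fiber_zero c]; split_ifs <;> simp) fun n hn =>
          h.card_fiber_of_pos c hn).mul_left (a c)
      have h3 : (fun n => (Nat.card {D : {D : FFDivisor k F // 0 ≤ D} //
          h.classIndex D = (c, n)} : 𝕜) * (a c * u ^ n)) = fun n => a c * ((Nat.card
          {D : {D : FFDivisor k F // 0 ≤ D} // h.classIndex D = (c, n)} : 𝕜) * u ^ n) := by
        funext n
        ring
      show HasSum (fun n => _) _
      rw [h3]
      exact h2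
  convert h1 using 1
  simp only [mul_add, Finset.sum_add_distrib, Finset.sum_mul]
  simp

theorem hasSum_effective (h : IsEllipticModel k R F inf) [Fintype (FFClassGroup.degZero k F)]
    (a : FFClassGroup.degZero k F → ℂ) {u : ℂ} (hu : ‖(Nat.card k : ℂ) * u‖ < 1) :
    HasSum (fun D : {D : FFDivisor k F // 0 ≤ D} =>
      a (h.classIndex D).1 * u ^ (h.classIndex D).2)
      (a 0 + (∑ c, a c) * (u / ((1 - u) * (1 - Nat.card k * u)))) := by
  rw [← (Equiv.sigmaFiberEquiv h.classIndex).hasSum_iff]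
  have hfib : ∀ (y : FFClassGroup.degZero k F × ℕ)
      (D : {D : {D : FFDivisor k F // 0 ≤ D} // h.classIndex D = y}),
      a (h.classIndex D.1).1 * u ^ (h.classIndex D.1).2 = a y.1 * u ^ y.2 := fun y D => by rw [D.2]
  refine HasSum.sigma_of_hasSum (h.hasSum_card_fiber a hu) (fun y => ?_) ?_
  · have := h.finite_fiber y
    have := Fintype.ofFinite {D : {D : FFDivisor k F // 0 ≤ D} // h.classIndex D = y}
    have hs := hasSum_fintype
      fun _ : {D : {D : FFDivisor k F // 0 ≤ D} // h.classIndex D = y} => a y.1 * u ^ y.2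
    rw [Finset.sum_const, Finset.card_univ, nsmul_eq_mul, ← Nat.card_eq_fintype_card] at hs
    simpa only [Function.comp_apply, Equiv.sigmaFiberEquiv_apply, hfib] using hs
  -- The norms form the same series with `‖a c‖` and `‖u‖` in place of `a c` and `u`.
  · refine Summable.of_norm ?_
    have hu' : ‖(Nat.card k : ℝ) * ‖u‖‖ < 1 := by
      simpa using hu
    rw [summable_sigma_of_nonneg fun _ => norm_nonneg _]
    refine ⟨fun y => ?_, ?_⟩
    · have := h.finite_fiber y
      exact Summable.of_finite
    · refine (h.hasSum_card_fiber (𝕜 := ℝ) (fun c => ‖a c‖) hu').summable.congr fun y => ?_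
      have := h.finite_fiber y
      have := Fintype.ofFinite {D : {D : FFDivisor k F // 0 ≤ D} // h.classIndex D = y}
      rw [tsum_fintype]
      simp only [Function.comp_apply, Equiv.sigmaFiberEquiv_apply, hfib, Finset.sum_const,
        Finset.card_univ, nsmul_eq_mul, Nat.card_eq_fintype_card, norm_mul, norm_pow]

theorem heckeLTerm_eq (h : IsEllipticModel k R F inf) (χ : UnramifiedHeckeCharacter k F) (s : ℂ)
    (D : {D : FFDivisor k F // 0 ≤ D}) :
    heckeLTerm χ s D.1 = χ (h.classIndex D).1 *
      (χ (placeClass inf) * (Nat.card k : ℂ) ^ (-s)) ^ (h.classIndex D).2 := by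
  have hD := FFDivisor.deg_nonneg D.2
  have h1 := (h.classIndex_eq_iff D _).1 rfl
  have h2 : ((h.classIndex D).2 : ℤ) = FFDivisor.deg k F D.1 := Int.toNat_of_nonneg hD
  rw [heckeLTerm, h1, ← h2, AddChar.map_add_eq_mul, AddChar.map_nsmul_eq_pow, mul_pow,
    ← Complex.cpow_nat_mul]
  push_cast
  rw [neg_mul, ← mul_neg, mul_assoc]

/-- The rational expression of the `L`-function. -/
noncomputable def rationalL (χ : UnramifiedHeckeCharacter k F) (inf : FFPlace k F) (S : ℂ) (s : ℂ) :
    ℂ :=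
  1 + S * (χ (placeClass inf) * (Nat.card k : ℂ) ^ (-s) /
    ((1 - χ (placeClass inf) * (Nat.card k : ℂ) ^ (-s)) *
      (1 - Nat.card k * (χ (placeClass inf) * (Nat.card k : ℂ) ^ (-s)))))

theorem hasSum_heckeLTerm (h : IsEllipticModel k R F inf) [Fintype (FFClassGroup.degZero k F)]
    (χ : UnramifiedHeckeCharacter k F) : ∃ σ : ℝ, ∀ s : ℂ, σ < s.re →
      ‖(Nat.card k : ℂ) * (χ (placeClass inf) * (Nat.card k : ℂ) ^ (-s))‖ < 1 ∧
      HasSum (fun D : {D : FFDivisor k F // 0 ≤ D} => heckeLTerm χ s D.1)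
        (rationalL χ inf (∑ c : FFClassGroup.degZero k F, χ c) s) := by
  have hq : 1 < (Nat.card k : ℝ) := by exact_mod_cast Finite.one_lt_card (α := k)
  have hlim : Tendsto (fun t : ℝ => (Nat.card k : ℝ) * (‖χ (placeClass inf)‖ *
      (Nat.card k : ℝ) ^ (-t))) atTop (𝓝 0) := by
    have h1 := (tendsto_rpow_atBot_of_base_gt_one _ hq).comp tendsto_neg_atTop_atBot
    simpa using (h1.const_mul ‖χ (placeClass inf)‖).const_mul (Nat.card k : ℝ)
  obtain ⟨σ, hσ⟩ := eventually_atTop.1 (hlim.eventually_lt_const one_pos)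
  refine ⟨σ, fun s hs => ?_⟩
  have hu : ‖(Nat.card k : ℂ) * (χ (placeClass inf) * (Nat.card k : ℂ) ^ (-s))‖ < 1 := by
    rw [norm_mul, norm_mul, Complex.norm_natCast_cpow_of_pos (Nat.card_pos), Complex.norm_natCast]
    simpa using hσ s.re hs.le
  refine ⟨hu, ?_⟩
  simp only [h.heckeLTerm_eq]
  have := h.hasSum_effective (fun c => χ c) hu
  rw [AddSubgroup.coe_zero, AddChar.map_zero_eq_one] at this
  exact this

theorem meromorphicAt_rationalL (χ : UnramifiedHeckeCharacter k F) (S s : ℂ) :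
    MeromorphicAt (rationalL χ inf S) s := by
  have hu : AnalyticAt ℂ (fun s : ℂ => χ (placeClass inf) * (Nat.card k : ℂ) ^ (-s)) s := by
    have : (Nat.card k : ℂ) ∈ Complex.slitPlane := by
      rw [Complex.natCast_mem_slitPlane]
      exact Nat.card_pos.ne'
    fun_prop (disch := exact this)
  have hm := hu.meromorphicAt
  exact (MeromorphicAt.const 1 s).add ((MeromorphicAt.const S s).mul (hm.div
    (((MeromorphicAt.const 1 s).sub hm).mul ((MeromorphicAt.const 1 s).sub
      ((MeromorphicAt.const (Nat.card k : ℂ) s).mul hm)))))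

theorem analyticAt_rationalL (χ : UnramifiedHeckeCharacter k F) (S s : ℂ)
    (h1 : 1 - χ (placeClass inf) * (Nat.card k : ℂ) ^ (-s) ≠ 0)
    (h2 : 1 - Nat.card k * (χ (placeClass inf) * (Nat.card k : ℂ) ^ (-s)) ≠ 0) :
    AnalyticAt ℂ (rationalL χ inf S) s := by
  have hu : AnalyticAt ℂ (fun s : ℂ => χ (placeClass inf) * (Nat.card k : ℂ) ^ (-s)) s := by
    have : (Nat.card k : ℂ) ∈ Complex.slitPlane := by
      rw [Complex.natCast_mem_slitPlane]
      exact Nat.card_pos.ne'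
    fun_prop (disch := exact this)
  exact analyticAt_const.add (analyticAt_const.mul (hu.div
    ((analyticAt_const.sub hu).mul (analyticAt_const.sub (analyticAt_const.mul hu)))
    (mul_ne_zero h1 h2)))

end IsEllipticModel

end

/-! ### Analytic continuation and the choice of the quadratic twist -/

section

open Filter Topology

/-- By the identity theorem the difference has infinite order everywhere, which gives equality near
`s` but not at `s`. The normal form supplies the value at `s`. -/
theorem MeromorphicNFOn.eventuallyEq_of_eqOn {L M : ℂ → ℂ} (hL : MeromorphicNFOn L Set.univ)
    (hM : Meromorphic M) {U : Set ℂ} (hU : IsOpen U) (hne : U.Nonempty) (hLM : Set.EqOn L M U)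
    {s : ℂ} (hs : AnalyticAt ℂ M s) : L =ᶠ[𝓝 s] M := by
  rw [← (hL (Set.mem_univ s)).eventuallyEq_nhdsNE_iff_eventuallyEq_nhds hs.meromorphicNFAt]
  have hL' : Meromorphic L := fun z => (hL (Set.mem_univ z)).meromorphicAt
  have hsub : Meromorphic (L - M) := fun z => (hL' z).sub (hM z)
  have htop : meromorphicOrderAt (L - M) s = ⊤ := by
    by_contra hs'
    obtain ⟨z, hz⟩ := hne
    refine (hsub.exists_meromorphicOrderAt_ne_top_iff_forall.1 ⟨s, hs'⟩) z ?_
    rw [meromorphicOrderAt_eq_top_iff]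
    exact nhdsWithin_le_nhds (eventually_of_mem (hU.mem_nhds hz) fun w hw => by
      rw [Pi.sub_apply, hLM hw, sub_self])
  filter_upwards [meromorphicOrderAt_eq_top_iff.1 htop] with z hz
  exact sub_eq_zero.1 hz

/-- The dual group has the same order as `G`, so Cauchy's theorem applies to it. -/
theorem exists_addChar_order_two (G : Type*) [AddCommGroup G] [Finite G] (hG : 2 ∣ Nat.card G) :
    ∃ ψ : AddChar G ℂ, ψ ≠ 1 ∧ ψ ^ 2 = 1 := by
  have := Fintype.ofFinite G
  have hc : Nat.card (AddChar G ℂ) = Nat.card G := by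
    rw [Nat.card_eq_fintype_card, AddChar.card_eq, Nat.card_eq_fintype_card]
  have : Fact (Nat.Prime 2) := ⟨Nat.prime_two⟩
  obtain ⟨ψ, hψ⟩ := exists_prime_orderOf_dvd_card' (G := AddChar G ℂ) 2 (hc ▸ hG)
  refine ⟨ψ, ?_, hψ ▸ pow_orderOf_eq_one ψ⟩
  rintro rfl
  simp at hψ

/-- The `L`-polynomial of an elliptic curve with `h` points cannot have both `u` and `-u` as
exceptional points, unless `h` takes one of two values. -/
theorem eq_or_eq_of_exceptional {q h : ℕ} {u : ℂ} (hu : u ≠ 0)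
    (h1 : 1 - u = 0 ∨ 1 - q * u = 0 ∨ (1 - u) * (1 - q * u) + h * u = 0)
    (h2 : 1 + u = 0 ∨ 1 + q * u = 0 ∨ (1 + u) * (1 + q * u) - h * u = 0) :
    h = 2 * (q + 1) ∨ h = q + 1 := by
  have key : ∀ a b : ℕ, (a : ℂ) = b → a = b := fun a b => by exact_mod_cast id
  have hqc' : (q : ℂ) + 1 ≠ 0 := by exact_mod_cast (by omega : q + 1 ≠ 0)
  rcases h1 with h1 | h1 | h1
  · have hu1 : u = 1 := by linear_combination -h1
    subst hu1
    rcases h2 with h2 | h2 | h2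
    · norm_num at h2
    · exact absurd (by linear_combination h2) hqc'
    · exact Or.inl (key _ _ (by push_cast; linear_combination -h2))
  · rcases h2 with h2 | h2 | h2
    · exact absurd (by linear_combination q * h2 + h1) hqc'
    · exact absurd (show (2 : ℂ) = 0 by linear_combination h1 + h2) two_ne_zero
    · refine Or.inl (key _ _ (mul_right_cancel₀ hu ?_))
      push_cast
      linear_combination -h2 + (1 - u) * h1
  · rcases h2 with h2 | h2 | h2
    · have hu1 : u = -1 := by linear_combination h2
      subst hu1
      exact Or.inl (key _ _ (by push_cast; linear_combination -h1))
    · refine Or.inl (key _ _ (mul_right_cancel₀ hu ?_))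
      push_cast
      linear_combination h1 - (1 + u) * h2
    · refine Or.inr (key _ _ (mul_right_cancel₀ hu ?_))
      push_cast
      linear_combination (h1 - h2) / 2

namespace IsEllipticModel

open FFPlace FFDivisor

variable {k R F : Type*} [Field k] [CommRing R] [IsDedekindDomain R] [Field F] [Algebra k R]
  [Algebra k F] [Algebra R F] [IsScalarTower k R F] [IsFractionRing R F] {inf : FFPlace k F}
  [Finite k] [Infinite R] [Ring.HasFiniteQuotients R]

/-- The normal form of the rational expression shows that a continuation exists. The chosen one
agrees with that expression on a half-plane, hence wherever the expression is analytic. -/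
theorem heckeL_eventuallyEq (h : IsEllipticModel k R F inf) [Fintype (FFClassGroup.degZero k F)]
    (χ : UnramifiedHeckeCharacter k F) {s : ℂ}
    (hs : AnalyticAt ℂ (rationalL χ inf (∑ c : FFClassGroup.degZero k F, χ c)) s) :
    heckeL χ =ᶠ[𝓝 s] rationalL χ inf (∑ c : FFClassGroup.degZero k F, χ c) := by
  set M := rationalL χ inf (∑ c : FFClassGroup.degZero k F, χ c)
  have hM : Meromorphic M := meromorphicAt_rationalL χ _
  obtain ⟨σ, hσ⟩ := h.hasSum_heckeLTerm χ
  have hex : ∃ L, IsHeckeLFunction χ L := by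
    refine ⟨toMeromorphicNFOn M Set.univ, meromorphicNFOn_toMeromorphicNFOn _ _, σ, fun z hz => ?_⟩
    obtain ⟨hu, hsum⟩ := hσ z hz
    have hu1 : ‖χ (placeClass inf) * (Nat.card k : ℂ) ^ (-z)‖ < 1 := by
      refine lt_of_le_of_lt ?_ hu
      rw [norm_mul (Nat.card k : ℂ), Complex.norm_natCast]
      exact le_mul_of_one_le_left (norm_nonneg _) (by exact_mod_cast Nat.card_pos)
    have hMz : AnalyticAt ℂ M z := by
      apply analyticAt_rationalL
      · intro h0
        rw [← sub_eq_zero.1 h0, norm_one] at hu1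
        exact lt_irrefl _ hu1
      · intro h0
        rw [← sub_eq_zero.1 h0, norm_one] at hu
        exact lt_irrefl _ hu
    rw [toMeromorphicNFOn_eq_toMeromorphicNFAt hM.meromorphicOn (Set.mem_univ z),
      toMeromorphicNFAt_eq_self.2 hMz.meromorphicNFAt]
    exact hsum
  rw [heckeL, dif_pos hex]
  obtain ⟨hL, τ, hτ⟩ := hex.choose_spec
  refine hL.eventuallyEq_of_eqOn hM (U := {z | max σ τ < z.re})
    (isOpen_lt continuous_const Complex.continuous_re) ⟨((max σ τ + 1 : ℝ) : ℂ), by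
      rw [Set.mem_ofPred_eq, Complex.ofReal_re]
      exact lt_add_one _⟩
    (fun z hz => ?_) hs
  exact (hτ z ((le_max_right _ _).trans_lt hz)).unique (hσ z ((le_max_left _ _).trans_lt hz)).2

/-- By orthogonality the character sum over `Cl⁰` vanishes, and `L` is the constant `1`. -/
theorem analyticAt_heckeL_of_restrict_ne_one (h : IsEllipticModel k R F inf)
    (χ : UnramifiedHeckeCharacter k F) (s : ℂ)
    (hχ : χ.compAddMonoidHom (FFClassGroup.degZero k F).subtype ≠ 1) :
    AnalyticAt ℂ (heckeL χ) s ∧ heckeL χ s ≠ 0 := by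
  have := h.finite_degZero
  have := Fintype.ofFinite (FFClassGroup.degZero k F)
  have hS : ∑ c : FFClassGroup.degZero k F, χ c = 0 := by
    simpa using (AddChar.sum_eq_zero_iff_ne_zero (ψ := χ.compAddMonoidHom
      (FFClassGroup.degZero k F).subtype)).2 hχ
  have hM : rationalL χ inf 0 = fun _ => 1 := by
    funext z
    simp [rationalL]
  have hL := h.heckeL_eventuallyEq χ (s := s) (by rw [hS, hM]; exact analyticAt_const)
  rw [hS, hM] at hL
  exact ⟨analyticAt_const.congr hL.symm, by rw [hL.eq_of_nhds]; exact one_ne_zero⟩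

/-- If the character is trivial in degree zero, the `L`-function is a translate of the zeta
function: its poles and zeros are those of an explicit rational function of `u`. -/
theorem analyticAt_heckeL_of_restrict_eq_one (h : IsEllipticModel k R F inf)
    (χ : UnramifiedHeckeCharacter k F) (s u : ℂ)
    (hu : χ (placeClass inf) * (Nat.card k : ℂ) ^ (-s) = u)
    (hχ : χ.compAddMonoidHom (FFClassGroup.degZero k F).subtype = 1)
    (hne : ¬(1 - u = 0 ∨ 1 - Nat.card k * u = 0 ∨
      (1 - u) * (1 - Nat.card k * u) + FFClassGroup.classNumber k F * u = 0)) :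
    AnalyticAt ℂ (heckeL χ) s ∧ heckeL χ s ≠ 0 := by
  have := h.finite_degZero
  have := Fintype.ofFinite (FFClassGroup.degZero k F)
  push Not at hne
  obtain ⟨h1, h2, h3⟩ := hne
  have hS : ∑ c : FFClassGroup.degZero k F, χ c = FFClassGroup.classNumber k F := by
    have h4 : ∀ c : FFClassGroup.degZero k F, χ c = 1 := fun c => DFunLike.congr_fun hχ c
    simp [h4, FFClassGroup.classNumber]
  subst hu
  have hM := analyticAt_rationalL χ (∑ c : FFClassGroup.degZero k F, χ c) s h1 h2
  have hL := h.heckeL_eventuallyEq χ hM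
  refine ⟨hM.congr hL.symm, ?_⟩
  rw [hL.eq_of_nhds, rationalL, hS, ← mul_div_assoc, one_add_div (mul_ne_zero h1 h2)]
  exact div_ne_zero h3 (mul_ne_zero h1 h2)

/-- The quadratic character of the class group that depends on the parity of the degree. -/
noncomputable def signChar (h : IsEllipticModel k R F inf) : UnramifiedHeckeCharacter k F where
  toFun c := (-1) ^ h.classDeg c
  map_zero_eq_one' := by rw [map_zero, zpow_zero]
  map_add_eq_mul' c d := by rw [map_add, zpow_add₀ (by norm_num)]

theorem signChar_apply (h : IsEllipticModel k R F inf) (c : FFClassGroup k F) :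
    h.signChar c = (-1) ^ h.classDeg c := rfl

theorem signChar_sq (h : IsEllipticModel k R F inf) : h.signChar ^ 2 = 1 := by
  ext c
  rw [AddChar.pow_apply, h.signChar_apply, AddChar.one_apply, ← zpow_natCast, ← zpow_mul,
    mul_comm, zpow_mul]
  simp

theorem exists_analyticAt_heckeL (h : IsEllipticModel k R F inf)
    (hF : ringChar F ≠ 2 ∨ FFClassGroup.classNumber k F ≠ Nat.card k + 1)
    (χ : UnramifiedHeckeCharacter k F) (s : ℂ) :
    ∃ ω : UnramifiedHeckeCharacter k F, ω ^ 2 = 1 ∧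
      AnalyticAt ℂ (heckeL (χ * ω)) s ∧ heckeL (χ * ω) s ≠ 0 := by
  have := h.finite_degZero
  by_cases hχ : χ.compAddMonoidHom (FFClassGroup.degZero k F).subtype = 1
  swap
  · exact ⟨1, one_pow 2, by
      rw [mul_one]
      exact h.analyticAt_heckeL_of_restrict_ne_one χ s hχ⟩
  have hχ1 : ∀ c : FFClassGroup.degZero k F, χ c = 1 := fun c => DFunLike.congr_fun hχ c
  by_cases heven : 2 ∣ FFClassGroup.classNumber k F
  · obtain ⟨ψ, hψ1, hψ2⟩ := exists_addChar_order_two (FFClassGroup.degZero k F) heven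
    -- The projection restricts to the identity on `Cl⁰`, so this extension of `ψ` is still
    -- quadratic and nontrivial there.
    refine ⟨ψ.compAddMonoidHom h.toDegZero, ?_, h.analyticAt_heckeL_of_restrict_ne_one _ s ?_⟩
    · ext c
      exact DFunLike.congr_fun hψ2 (h.toDegZero c)
    · contrapose! hψ1
      ext c
      have h1 : χ c * ψ (h.toDegZero c) = 1 := DFunLike.congr_fun hψ1 c
      rwa [hχ1, one_mul, h.toDegZero_coe] at h1
  by_contra! hbad
  have hb1 := hbad 1 (one_pow 2)
  have hb2 := hbad h.signChar h.signChar_sq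
  rw [mul_one] at hb1
  set u := χ (placeClass inf) * (Nat.card k : ℂ) ^ (-s) with hu
  have hu0 : u ≠ 0 := mul_ne_zero (χ.val_isUnit _).ne_zero (by
    rw [Complex.cpow_ne_zero_iff]
    exact Or.inl (Nat.cast_ne_zero.2 Nat.card_pos.ne'))
  have h1 := not_not.1 fun hne => (fun hh => hh.2 (hb1 hh.1))
    (h.analyticAt_heckeL_of_restrict_eq_one χ s u hu.symm hχ hne)
  -- At `[∞]`, of degree one, the sign character is `-1`, so the twist replaces `u` by `-u`; on
  -- `Cl⁰` it changes nothing.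
  have h2 := not_not.1 fun hne => (fun hh => hh.2 (hb2 hh.1))
    (h.analyticAt_heckeL_of_restrict_eq_one (χ * h.signChar) s (-u) (by
      rw [AddChar.mul_apply, h.signChar_apply, h.classDeg_inf, hu]
      ring) (by
      ext c
      show χ c * h.signChar c = 1
      rw [hχ1, h.signChar_apply, (h.mem_degZero_iff _).1 c.2, zpow_zero, one_mul]) hne)
  rcases eq_or_eq_of_exceptional hu0 h1
    (by simpa [sub_neg_eq_add, ← sub_eq_add_neg] using h2) with h3 | h3
  · exact heven (h3 ▸ dvd_mul_right 2 _)
  · rcases hF with hF | hF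
    · have := Fintype.ofFinite k
      rw [← Algebra.ringChar_eq k F] at hF
      have h4 := FiniteField.odd_card_of_char_ne_two hF
      rw [← Nat.card_eq_fintype_card] at h4
      omega
    · exact hF h3

end IsEllipticModel

end

theorem mainTheorem10 {k F : Type*} [Field k] [Finite k] [Field F] [Algebra k F]
    (hF : IsEllipticFunctionField k F)
    (h : ringChar F ≠ 2 ∨ FFClassGroup.classNumber k F ≠ Nat.card k + 1)
    (χ : UnramifiedHeckeCharacter k F) (s : ℂ) :
    ∃ ω : UnramifiedHeckeCharacter k F, ω ^ 2 = 1 ∧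
      AnalyticAt ℂ (heckeL (χ * ω)) s ∧ heckeL (χ * ω) s ≠ 0 := by
  obtain ⟨W, hW, ⟨e⟩⟩ := hF
  let f : W.toAffine.CoordinateRing →ₐ[k] F := e.symm.toAlgHom.comp
    (IsScalarTower.toAlgHom k W.toAffine.CoordinateRing W.toAffine.FunctionField)
  -- The isomorphism makes `F` itself a fraction field of the coordinate ring, so no class group or
  -- `L`-function has to be transported.
  let : Algebra W.toAffine.CoordinateRing F := f.toRingHom.toAlgebra
  have : IsScalarTower k W.toAffine.CoordinateRing F :=
    IsScalarTower.of_algebraMap_eq fun c => (f.commutes c).symm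
  let e' : W.toAffine.FunctionField ≃ₐ[W.toAffine.CoordinateRing] F :=
    AlgEquiv.ofRingEquiv (f := e.symm.toRingEquiv) fun _ => rfl
  have : IsFractionRing W.toAffine.CoordinateRing F :=
    IsLocalization.isLocalization_of_algEquiv _ e'
  exact (W.toAffine.isEllipticModel F).exists_analyticAt_heckeL h χ s
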